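/- **Conventions.** A digraph $T$ is finite and loopless; between two distinct vertices there may be an edge in either direction or in both. A set $k$ of vertices is a kernel of $T$ if no two vertices of $k$ are adjacent and every vertex outside of $k$ has an out-neighbour in $k$. Write $|T|$ for the number of vertices of $T$ and $\operatorname{size} T$ for the number of vertices plus the number of directed edges (a bidirectional edge counts as two), and let $\omega(T)$ be the clique number of the undirected graph underlying $T$. An undirected graph is a threshold graph if it can be built from a single vertex by repeatedly taking the disjoint union, or the join, of a single new vertex and the graph built so far. An arbitrarily oriented threshold graph is a digraph whose underlying undirected graph is a threshold graph. Running times refer to a unit-cost random access machine with finitely many word variables and word arrays, whose elementary operations are constants, copying, addition, truncated subtraction, array access, comparison and output, and whose words have $\mathcal O(\log(\operatorname{size} T + 1))$ bits. A digraph with vertex set $\{0,\dots,n-1\}$ is input as the number $n$, the number of directed edges, and the list of its directed edges in an arbitrary order, each listed exactly once. Only the digraph is given, not a construction sequence. **Theorem.** Let $T$ range over the arbitrarily oriented threshold graphs with vertex set $\{0,\dots,n-1\}$, where $n \geq 1$ is arbitrary. 1. There is an algorithm that, given $T$, outputs in time $\mathcal O(\operatorname{size} T)$ the number of kernels of $T$,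 followed by the list of the vertices of one kernel of $T$ if a kernel exists (and by nothing otherwise). 2. There is an algorithm that, given $T$, outputs in time $\mathcal O(\omega(T)\cdot|T| + \operatorname{size} T)$ all the kernels of $T$, each exactly once; each kernel is output as its number of vertices followed by the list of its vertices. -/

import Mathlib

/-! ### Digraphs, kernels and threshold graphs -/

namespace Digraph

/-- No vertex is adjacent to itself. Both arcs `(u, v)` and `(v, u)` may be present for `u ≠ v`. -/
def IsLoopless {V : Type*} (D : Digraph V) : Prop :=
  ∀ v, ¬ D.Adj v v

/-- `k` is a kernel of `D`: an independent set such that every vertex outside of `k` has an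
out-neighbour in `k`. -/
def IsKernel {V : Type*} (D : Digraph V) (k : Finset V) : Prop :=
  (∀ u ∈ k, ∀ v ∈ k, ¬ D.Adj u v) ∧ (∀ u, u ∉ k → ∃ v ∈ k, D.Adj u v)

/-- The number of vertices plus the number of arcs (a bidirectional edge consists of two arcs). -/
noncomputable def size {V : Type*} (D : Digraph V) : ℕ :=
  Nat.card V + Nat.card {e : V × V // D.Adj e.1 e.2}

/-- `L` lists the arcs of `D`, each exactly once, in an arbitrary order. -/
def IsArcList {V : Type*} (D : Digraph V) (L : List (V × V)) : Prop :=
  L.Nodup ∧ ∀ u v, (u, v) ∈ L ↔ D.Adj u v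

end Digraph

namespace SimpleGraph

/-- `G.IsThresholdOn S`: the subgraph of `G` induced by `S` has a construction sequence that starts
from a single vertex and at each step takes the disjoint union, or the join, of a single new vertex
and the graph built so far. -/
inductive IsThresholdOn {V : Type*} (G : SimpleGraph V) : Set V → Prop
  | single (v : V) : IsThresholdOn G {v}
  | union (v : V) (S : Set V) (hv : v ∉ S) (h : ∀ u ∈ S, ¬ G.Adj v u) (hS : IsThresholdOn G S) :
      IsThresholdOn G (insert v S)
  | join (v : V) (S : Set V) (hv : v ∉ S) (h : ∀ u ∈ S, G.Adj v u) (hS : IsThresholdOn G S) :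
      IsThresholdOn G (insert v S)

/-- Threshold graphs. -/
def IsThreshold {V : Type*} (G : SimpleGraph V) : Prop :=
  G.IsThresholdOn Set.univ

end SimpleGraph

/-! ### A unit-cost random access machine

Programs act on word variables and on one-dimensional word arrays, both named by natural numbers
that are fixed in the program text, so that a program uses finitely many of them. All array cells
are accessible in constant time. The arithmetic consists of addition and truncated subtraction.
There is a write-only output tape. Numbers must fit in a machine word: a run on a machine with
words `0, …, W - 1` fails as soon as it would form a number `≥ W`. -/

namespace RAM

/-- Elementary instructions; each takes one unit of time. -/
inductive Instr
  /-- `x := a` -/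
  | const (x a : ℕ)
  /-- `x := y` -/
  | move (x y : ℕ)
  /-- `x := y + z` -/
  | add (x y z : ℕ)
  /-- `x := y - z`, or `0` if `y < z` -/
  | sub (x y z : ℕ)
  /-- `x := A[y]` -/
  | load (x A y : ℕ)
  /-- `A[x] := y` -/
  | store (A x y : ℕ)
  /-- append `x` to the output tape -/
  | output (x : ℕ)

/-- Comparisons of two variables; each takes one unit of time. -/
inductive Test
  | lt (x y : ℕ)
  | eq (x y : ℕ)

/-- Programs. -/
inductive Program
  | skip
  | instr (i : Instr)
  | seq (p q : Program)
  | ite (b : Test) (p q : Program)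
  | while (b : Test) (p : Program)

/-- Machine states. -/
structure State where
  /-- the contents of the variables -/
  var : ℕ → ℕ
  /-- the contents of the arrays -/
  arr : ℕ → ℕ → ℕ
  /-- the output written so far -/
  out : List ℕ

/-- `x := a` -/
def State.setVar (s : State) (x a : ℕ) : State :=
  { s with var := Function.update s.var x a }

/-- `A[i] := a` -/
def State.setArr (s : State) (A i a : ℕ) : State :=
  { s with arr := Function.update s.arr A (Function.update (s.arr A) i a) }

/-- The effect of an instruction on a machine with words `0, …, W - 1`; `none` is an overflow. -/
def Instr.step (W : ℕ) (s : State) : Instr → Option State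
  | .const x a => if a < W then some (s.setVar x a) else none
  | .move x y => some (s.setVar x (s.var y))
  | .add x y z => if s.var y + s.var z < W then some (s.setVar x (s.var y + s.var z)) else none
  | .sub x y z => some (s.setVar x (s.var y - s.var z))
  | .load x A y => some (s.setVar x (s.arr A (s.var y)))
  | .store A x y => some (s.setArr A (s.var x) (s.var y))
  | .output x => some { s with out := s.out ++ [s.var x] }

/-- The outcome of a test. -/
def Test.holds (s : State) : Test → Prop
  | .lt x y => s.var x < s.var y
  | .eq x y => s.var x = s.var y

/-- `Exec W p s t s'`: on a machine with words `0, …, W - 1`, the program `p` started in the state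
`s` halts without overflow after exactly `t` units of time, in the state `s'`. -/
inductive Exec (W : ℕ) : Program → State → ℕ → State → Prop
  | skip (s : State) : Exec W .skip s 1 s
  | instr (i : Instr) (s s' : State) (h : i.step W s = some s') : Exec W (.instr i) s 1 s'
  | seq (p q : Program) (s s' s'' : State) (t t' : ℕ) (hp : Exec W p s t s')
      (hq : Exec W q s' t' s'') : Exec W (.seq p q) s (t + t') s''
  | ite_true (b : Test) (p q : Program) (s s' : State) (t : ℕ) (hb : b.holds s)
      (hp : Exec W p s t s') : Exec W (.ite b p q) s (1 + t) s'
  | ite_false (b : Test) (p q : Program) (s s' : State) (t : ℕ) (hb : ¬ b.holds s)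
      (hq : Exec W q s t s') : Exec W (.ite b p q) s (1 + t) s'
  | while_true (b : Test) (p : Program) (s s' s'' : State) (t t' : ℕ) (hb : b.holds s)
      (hp : Exec W p s t s') (hw : Exec W (.while b p) s' t' s'') :
      Exec W (.while b p) s (1 + t + t') s''
  | while_false (b : Test) (p : Program) (s : State) (hb : ¬ b.holds s) :
      Exec W (.while b p) s 1 s

/-- The initial state for a digraph with vertices `0, …, n - 1` and arc list `L`: variable `0` holds
the number of vertices, variable `1` the number of arcs, and arrays `0` and `1` hold the tails and
the heads of the arcs in the order of the list. Everything else is zero and nothing is output. -/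
def input (n : ℕ) (L : List (Fin n × Fin n)) : State where
  var := fun x => if x = 0 then n else if x = 1 then L.length else 0
  arr := fun A i =>
    if A = 0 then (L.map fun e => (e.1 : ℕ)).getD i 0
    else if A = 1 then (L.map fun e => (e.2 : ℕ)).getD i 0
    else 0
  out := []

/-- On a machine with words `0, …, W - 1`, the program `p` started in the state `s` halts without
overflow within `t` units of time, and the output tape then holds `o`. -/
def OutputsWithin (W : ℕ) (p : Program) (s : State) (t : ℕ) (o : List ℕ) : Prop :=
  ∃ t' ≤ t, ∃ s', Exec W p s t' s' ∧ s'.out = o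

end RAM

/-! ### Reasoning about programs -/

namespace RAM

-- Fix a construction sequence of the underlying threshold graph and call a vertex dominating if it
-- is adjacent to all earlier vertices; the first vertex counts as dominating. A vertex that is not
-- dominating is adjacent to no earlier vertex. Every kernel contains a dominating vertex: either
-- the first vertex lies in it, or the out-neighbour absorbing the first vertex is dominating.
-- Dominating vertices are pairwise adjacent, so this vertex `c` is unique. Vertices before `c` are
-- adjacent to `c` and hence excluded. A later vertex that is not dominating has only later
-- dominating neighbours, which are excluded, so it must belong to the kernel. Thus a kernel is the
-- set `candidate` of its vertex `c` (`IsThresholdOrder.isKernel_iff`), and there are at most as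
-- many kernels as dominating vertices, which form a clique (`Prepared.card_le_cliqueNum`).
--
-- Each candidate is independent, so only absorption has to be tested, for all `c` together in
-- linear time. Let `f u` be the largest position of a vertex that is not dominating in the closed
-- out-neighbourhood of `u`, or `0`. The later part of the candidate contains or absorbs `u` exactly
-- if `pos c < f u`. All other vertices must be `c` or have an arc to `c`, which is an equality of
-- two numbers (`count_iff`): one is a prefix sum of the histogram of `f`, the other is obtained in
-- a single pass over the arcs.
--
-- A construction sequence is found by removing dominating or isolated vertices. After the removal
-- of `D` dominating vertices, with `r + 1` vertices left, the dominating ones have original degree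
-- `D + r` and the isolated ones `D`. Hence the vertices are bucketed by degree once and the degrees
-- never change (`Peeled.step`, `peelLoop_run`). Writing the kernels out costs `O(n)` each, whence
-- the term `ω(T)·|T|`.

infixr:60 " ;; " => Program.seq

@[simp] theorem State.var_setVar (s : State) (x a y : ℕ) :
    (s.setVar x a).var y = if y = x then a else s.var y := by
  simp [State.setVar, Function.update_apply]

@[simp] theorem State.arr_setVar (s : State) (x a : ℕ) : (s.setVar x a).arr = s.arr := rfl

@[simp] theorem State.out_setVar (s : State) (x a : ℕ) : (s.setVar x a).out = s.out := rfl

@[simp] theorem State.var_setArr (s : State) (A i a : ℕ) : (s.setArr A i a).var = s.var := rfl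

@[simp] theorem State.arr_setArr (s : State) (A i a B : ℕ) :
    (s.setArr A i a).arr B = if B = A then Function.update (s.arr A) i a else s.arr B := by
  simp only [State.setArr, Function.update_apply]

@[simp] theorem State.out_setArr (s : State) (A i a : ℕ) : (s.setArr A i a).out = s.out := rfl

/-- Appending a word to the output tape. -/
def State.emit (s : State) (a : ℕ) : State :=
  { s with out := s.out ++ [a] }

@[simp] theorem State.var_emit (s : State) (a : ℕ) : (s.emit a).var = s.var := rfl

@[simp] theorem State.arr_emit (s : State) (a : ℕ) : (s.emit a).arr = s.arr := rfl

@[simp] theorem State.out_emit (s : State) (a : ℕ) : (s.emit a).out = s.out ++ [a] := rfl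

attribute [simp] Test.holds

/-- The program `p` started in `s` halts without overflow within time `t` in a state satisfying
`Q`. -/
def Run (W : ℕ) (p : Program) (s : State) (t : ℕ) (Q : State → Prop) : Prop :=
  ∃ t' ≤ t, ∃ s', Exec W p s t' s' ∧ Q s'

theorem Run.mono {W : ℕ} {p : Program} {s : State} {t t' : ℕ} {Q Q' : State → Prop}
    (h : Run W p s t Q) (ht : t ≤ t') (hQ : ∀ s', Q s' → Q' s') : Run W p s t' Q' := by
  obtain ⟨t₁, h₁, s', he, hq⟩ := h
  exact ⟨t₁, h₁.trans ht, s', he, hQ s' hq⟩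

theorem Run.seq {W : ℕ} {p q : Program} {s : State} {t t' : ℕ} {Q : State → Prop}
    (h : Run W p s t fun s' => Run W q s' t' Q) : Run W (p ;; q) s (t + t') Q := by
  obtain ⟨t₁, h₁, s₁, he₁, t₂, h₂, s₂, he₂, hq⟩ := h
  exact ⟨t₁ + t₂, by omega, s₂, .seq _ _ _ _ _ _ _ he₁ he₂, hq⟩

theorem Run.ite {W : ℕ} {b : Test} {p q : Program} {s : State} {t : ℕ} {Q : State → Prop}
    (hp : b.holds s → Run W p s t Q) (hq : ¬ b.holds s → Run W q s t Q) :
    Run W (.ite b p q) s (1 + t) Q := by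
  by_cases hb : b.holds s
  · obtain ⟨t', ht, s', he, h⟩ := hp hb
    exact ⟨1 + t', by omega, s', .ite_true _ _ _ _ _ _ hb he, h⟩
  · obtain ⟨t', ht, s', he, h⟩ := hq hb
    exact ⟨1 + t', by omega, s', .ite_false _ _ _ _ _ _ hb he, h⟩

/-- The weakest precondition of an instruction. -/
def Instr.wp (W : ℕ) (Q : State → Prop) (s : State) : Instr → Prop
  | .const x a => a < W ∧ Q (s.setVar x a)
  | .move x y => Q (s.setVar x (s.var y))
  | .add x y z => s.var y + s.var z < W ∧ Q (s.setVar x (s.var y + s.var z))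
  | .sub x y z => Q (s.setVar x (s.var y - s.var z))
  | .load x A y => Q (s.setVar x (s.arr A (s.var y)))
  | .store A x y => Q (s.setArr A (s.var x) (s.var y))
  | .output x => Q (s.emit (s.var x))

/-- The weakest precondition of a program without loops. -/
def Program.wp (W : ℕ) : Program → (State → Prop) → State → Prop
  | .skip, Q, s => Q s
  | .instr i, Q, s => i.wp W Q s
  | .seq p q, Q, s => p.wp W (fun s' => q.wp W Q s') s
  | .ite b p q, Q, s => (b.holds s → p.wp W Q s) ∧ (¬ b.holds s → q.wp W Q s)
  | .while _ _, _, _ => False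

/-- A bound for the running time of a program without loops. -/
def Program.cost : Program → ℕ
  | .skip => 1
  | .instr _ => 1
  | .seq p q => p.cost + q.cost
  | .ite _ p q => 1 + max p.cost q.cost
  | .while _ _ => 0

/-- The postcondition `Q` may itself be a `Run` statement about the rest of the program, so that
loop-free prefixes can be stripped off in front of loops. -/
theorem Run.of_wp {W : ℕ} {p : Program} {s : State} {Q : State → Prop} (h : p.wp W Q s) :
    Run W p s p.cost Q := by
  induction p generalizing s Q with
  | skip => exact ⟨1, le_rfl, s, .skip s, h⟩
  | instr i =>
    refine ⟨1, le_rfl, ?_⟩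
    cases i <;> simp only [Program.wp, Instr.wp] at h
    case const x a => exact ⟨_, .instr _ _ _ (by simp [Instr.step, h.1]), h.2⟩
    case add x y z => exact ⟨_, .instr _ _ _ (by simp [Instr.step, h.1]), h.2⟩
    all_goals exact ⟨_, .instr _ _ _ rfl, h⟩
  | seq p q hp hq => exact Run.seq ((hp h).mono le_rfl fun s' => hq)
  | ite b p q hp hq =>
    exact Run.ite (fun hb => (hp (h.1 hb)).mono (le_max_left _ _) fun _ h => h)
      (fun hb => (hq (h.2 hb)).mono (le_max_right _ _) fun _ h => h)
  | _ => exact h.elim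

/-- The variables written by an instruction. -/
def Instr.vars : Instr → List ℕ
  | .const x _ => [x]
  | .move x _ => [x]
  | .add x _ _ => [x]
  | .sub x _ _ => [x]
  | .load x _ _ => [x]
  | .store _ _ _ => []
  | .output _ => []

/-- The arrays written by an instruction. -/
def Instr.arrs : Instr → List ℕ
  | .store A _ _ => [A]
  | _ => []

/-- Whether an instruction leaves the output tape alone. -/
def Instr.silent : Instr → Bool
  | .output _ => false
  | _ => true

/-- The variables written by a program. -/
def Program.vars : Program → List ℕ
  | .skip => []
  | .instr i => i.vars
  | .seq p q => p.vars ++ q.vars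
  | .ite _ p q => p.vars ++ q.vars
  | .while _ p => p.vars

/-- The arrays written by a program. -/
def Program.arrs : Program → List ℕ
  | .skip => []
  | .instr i => i.arrs
  | .seq p q => p.arrs ++ q.arrs
  | .ite _ p q => p.arrs ++ q.arrs
  | .while _ p => p.arrs

/-- Whether a program leaves the output tape alone. -/
def Program.silent : Program → Bool
  | .skip => true
  | .instr i => i.silent
  | .seq p q => p.silent && q.silent
  | .ite _ p q => p.silent && q.silent
  | .while _ p => p.silent

/-- The state `s'` differs from `s` only in the places that the program `p` writes to. -/
structure Frame (p : Program) (s s' : State) : Prop where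
  var : ∀ x, x ∉ p.vars → s'.var x = s.var x
  arr : ∀ A, A ∉ p.arrs → s'.arr A = s.arr A
  out : p.silent = true → s'.out = s.out

theorem Frame.refl (p : Program) (s : State) : Frame p s s :=
  ⟨fun _ _ => rfl, fun _ _ => rfl, fun _ => rfl⟩

theorem Frame.trans {p : Program} {s s' s'' : State} (h : Frame p s s') (h' : Frame p s' s'') :
    Frame p s s'' :=
  ⟨fun x hx => (h'.var x hx).trans (h.var x hx), fun A hA => (h'.arr A hA).trans (h.arr A hA),
    fun ho => (h'.out ho).trans (h.out ho)⟩

theorem Frame.weaken {p q : Program} {s s' : State} (h : Frame p s s') (hv : p.vars ⊆ q.vars)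
    (ha : p.arrs ⊆ q.arrs) (ho : q.silent = true → p.silent = true) : Frame q s s' :=
  ⟨fun x hx => h.var x fun h => hx (hv h), fun A hA => h.arr A fun h => hA (ha h),
    fun h' => h.out (ho h')⟩

/-- What a program cannot write is read off its text. Loop invariants therefore only mention what
changes, and everything else is transported by deciding membership in explicit lists. -/
theorem Exec.frame {W : ℕ} {p : Program} {s s' : State} {t : ℕ} (h : Exec W p s t s') :
    Frame p s s' := by
  induction h with
  | skip s => exact Frame.refl _ _
  | instr i s s' h =>
    cases i <;> simp only [Instr.step, Option.ite_none_right_eq_some, Option.some.injEq] at h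
    case const x a =>
      obtain ⟨-, rfl⟩ := h
      exact ⟨fun y hy => by simp_all [Program.vars, Instr.vars], fun _ _ => rfl, fun _ => rfl⟩
    case add x y z =>
      obtain ⟨-, rfl⟩ := h
      exact ⟨fun y hy => by simp_all [Program.vars, Instr.vars], fun _ _ => rfl, fun _ => rfl⟩
    case store A x y =>
      subst h
      exact ⟨fun _ _ => rfl, fun y hy => by simp_all [Program.arrs, Instr.arrs], fun _ => rfl⟩
    case output x =>
      subst h
      exact ⟨fun _ _ => rfl, fun _ _ => rfl, fun h => by simp [Program.silent, Instr.silent] at h⟩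
    all_goals
      subst h
      exact ⟨fun y hy => by simp_all [Program.vars, Instr.vars], fun _ _ => rfl, fun _ => rfl⟩
  | seq p q s s' s'' t t' _ _ hp hq =>
    exact (hp.weaken (by simp [Program.vars]) (by simp [Program.arrs])
      (by simp +contextual [Program.silent])).trans
      (hq.weaken (by simp [Program.vars]) (by simp [Program.arrs])
      (by simp +contextual [Program.silent]))
  | ite_true b p q s s' t _ _ hp =>
    exact hp.weaken (by simp [Program.vars]) (by simp [Program.arrs])
      (by simp +contextual [Program.silent])
  | ite_false b p q s s' t _ _ hq =>
    exact hq.weaken (by simp [Program.vars]) (by simp [Program.arrs])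
      (by simp +contextual [Program.silent])
  | while_true b p s s' s'' t t' _ _ _ hp hw => exact Frame.trans ⟨hp.1, hp.2, hp.3⟩ hw
  | while_false b p s _ => exact Frame.refl _ _

theorem Run.frame {W : ℕ} {p : Program} {s : State} {t : ℕ} {Q : State → Prop}
    (h : Run W p s t Q) : Run W p s t fun s' => Frame p s s' ∧ Q s' := by
  obtain ⟨t', ht, s', he, hq⟩ := h
  exact ⟨t', ht, s', he, he.frame, hq⟩

/-- Sequential composition, where the second program may use what the first one leaves alone. -/
theorem Run.andThen {W : ℕ} {p q : Program} {s : State} {t t' : ℕ} {Q R : State → Prop}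
    (hp : Run W p s t R) (hq : ∀ s', Frame p s s' → R s' → Run W q s' t' Q) :
    Run W (p ;; q) s (t + t') Q :=
  Run.seq (hp.frame.mono le_rfl fun s' h => hq s' h.1 h.2)

/-- `for i := 0, …, lim - 1 do p`; variable `2` must hold the number `1`. -/
def forLoop (i lim : ℕ) (p : Program) : Program :=
  .instr (.const i 0) ;; .while (.lt i lim) (p ;; .instr (.add i i 2))

/-- The cost of a round may depend on the counter; this matters where only the marked positions are
expensive. Each round pays 2 more for the test and the increment, and the final 2 covers the
initialisation and the failing test. -/
theorem Run.forLoop {W i lim N : ℕ} {p : Program} {s : State} {t : ℕ → ℕ}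
    (Inv : ℕ → State → Prop) (hi : i ≠ lim ∧ i ≠ 2) (hp : i ∉ p.vars ∧ lim ∉ p.vars ∧ 2 ∉ p.vars)
    (hN : s.var lim = N) (h1 : s.var 2 = 1) (hW : N < W) (h0 : Inv 0 (s.setVar i 0))
    (hstep : ∀ k < N, ∀ s', Frame (forLoop i lim p) s s' → s'.var i = k → Inv k s' →
      Run W p s' (t k) fun s'' => Inv (k + 1) (s''.setVar i (k + 1))) :
    Run W (forLoop i lim p) s (∑ k ∈ Finset.range N, (t k + 2) + 2) (Inv N) := by
  have hv : (RAM.forLoop i lim p).vars = i :: (p.vars ++ [i]) := rfl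
  have ha : (RAM.forLoop i lim p).arrs = p.arrs ++ [] := rfl
  have ho : (RAM.forLoop i lim p).silent = (p.silent && true) := by
    simp [RAM.forLoop, Program.silent, Instr.silent]
  -- Induction on the number `d` of rounds that remain.
  have main : ∀ d k, k + d = N → ∀ s', Frame (RAM.forLoop i lim p) s s' → s'.var i = k →
      Inv k s' → Run W (.while (.lt i lim) (p ;; .instr (.add i i 2))) s'
        (∑ j ∈ Finset.range d, (t (k + j) + 2) + 1) (Inv N) := by
    have hlim : ∀ s', Frame (RAM.forLoop i lim p) s s' → s'.var lim = N := fun s' h => by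
      rw [h.var lim (by rw [hv]; simp [hp.2.1, hi.1.symm]), hN]
    have hone : ∀ s', Frame (RAM.forLoop i lim p) s s' → s'.var 2 = 1 := fun s' h => by
      rw [h.var 2 (by rw [hv]; simp [hp.2.2, hi.2.symm]), h1]
    intro d
    induction d with
    | zero =>
      intro k hk s' hf hs' hI
      refine ⟨1, by simp, s', .while_false _ _ _ ?_, ?_⟩
      · simp [hs', hlim s' hf]; omega
      · rwa [← hk]
    | succ d ih =>
      intro k hk s' hf hs' hI
      obtain ⟨t₁, ht₁, s₁, he₁, hI₁⟩ := hstep k (by omega) s' hf hs' hI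
      have hf₁ : Frame (RAM.forLoop i lim p) s s₁ := hf.trans (he₁.frame.weaken
        (by rw [hv]; simp) (by rw [ha]; simp) (by rw [ho]; simp))
      have hi₁ : s₁.var i = k := by rw [he₁.frame.var i hp.1, hs']
      have hf₂ : Frame (RAM.forLoop i lim p) s (s₁.setVar i (k + 1)) :=
        ⟨fun x hx => by
          rw [State.var_setVar, if_neg (by rintro rfl; simp [hv] at hx), hf₁.var x hx],
          hf₁.arr, hf₁.out⟩
      obtain ⟨t₂, ht₂, s₂, he₂, hI₂⟩ := ih (k + 1) (by omega) _ hf₂ (by simp) hI₁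
      refine ⟨1 + (t₁ + 1) + t₂, ?_, s₂, .while_true _ _ _ _ _ _ _ ?_
        (.seq _ _ _ _ _ _ _ he₁ (.instr _ _ _ ?_)) he₂, hI₂⟩
      · rw [Finset.sum_range_succ']
        have : ∀ j, t (k + 1 + j) = t (k + (j + 1)) := fun j => by congr 1; omega
        simp only [this] at ht₂
        simp only [add_zero]
        omega
      · simp [hs', hlim s' hf]; omega
      · simp only [Instr.step, hi₁, hone s₁ hf₁]
        rw [if_pos (by omega)]
  obtain ⟨t₁, ht₁, s₁, he₁, hI₁⟩ := main N 0 (by omega) (s.setVar i 0)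
    ⟨fun x hx => by rw [State.var_setVar, if_neg (by rintro rfl; simp [hv] at hx)],
      fun _ _ => rfl, fun _ => rfl⟩ (by simp) h0
  refine ⟨1 + t₁, ?_, s₁, .seq _ _ _ _ _ _ _ (.instr _ _ _ ?_) he₁, hI₁⟩
  · simp only [zero_add] at ht₁
    omega
  · simp only [Instr.step]
    rw [if_pos (by omega)]

/-- Loops without inner loops. -/
theorem Run.forLoop_wp {W i lim N : ℕ} {p : Program} {s : State}
    (Inv : ℕ → State → Prop) (hi : i ≠ lim ∧ i ≠ 2) (hp : i ∉ p.vars ∧ lim ∉ p.vars ∧ 2 ∉ p.vars)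
    (hN : s.var lim = N) (h1 : s.var 2 = 1) (hW : N < W) (h0 : Inv 0 (s.setVar i 0))
    (hstep : ∀ k < N, ∀ s', Frame (RAM.forLoop i lim p) s s' → s'.var i = k → Inv k s' →
      p.wp W (fun s'' => Inv (k + 1) (s''.setVar i (k + 1))) s') :
    Run W (RAM.forLoop i lim p) s (N * (p.cost + 2) + 2) (Inv N) := by
  have := Run.forLoop (t := fun _ => p.cost) Inv hi hp hN h1 hW h0
    fun k hk s' hf hk' hI => Run.of_wp (hstep k hk s' hf hk' hI)
  simpa using this

end RAM

/-! ### Degrees in the underlying graph and bucketing by degree. -/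

namespace RAM

/-- `tl e` and `hd e`, for `e < m`, are the end points of pairwise distinct arcs on the vertices
`0, …, n - 1`, without loops. -/
structure ArcData (n m : ℕ) (tl hd : ℕ → ℕ) : Prop where
  tl_lt : ∀ e < m, tl e < n
  hd_lt : ∀ e < m, hd e < n
  ne : ∀ e < m, tl e ≠ hd e
  inj : ∀ e < m, ∀ e' < m, tl e = tl e' → hd e = hd e' → e = e'

/-- There is an arc from `u` to `v` among the first `k` arcs. -/
def Arc (tl hd : ℕ → ℕ) (k u v : ℕ) : Prop :=
  ∃ e < k, tl e = u ∧ hd e = v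

/-- `u` and `v` are joined by one of the first `k` arcs. -/
def Nbr (tl hd : ℕ → ℕ) (k u v : ℕ) : Prop :=
  Arc tl hd k u v ∨ Arc tl hd k v u

theorem not_arc_zero {tl hd : ℕ → ℕ} {u v : ℕ} : ¬ Arc tl hd 0 u v := by
  rintro ⟨e, he, -⟩
  omega

theorem arc_succ {tl hd : ℕ → ℕ} {k u v : ℕ} :
    Arc tl hd (k + 1) u v ↔ Arc tl hd k u v ∨ (tl k = u ∧ hd k = v) := by
  constructor
  · rintro ⟨e, he, h⟩
    rcases Nat.lt_succ_iff_lt_or_eq.1 he with h' | rfl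
    · exact .inl ⟨e, h', h⟩
    · exact .inr h
  · rintro (⟨e, he, h⟩ | h)
    · exact ⟨e, by omega, h⟩
    · exact ⟨k, by omega, h⟩

theorem nbr_comm {tl hd : ℕ → ℕ} {k u v : ℕ} : Nbr tl hd k u v ↔ Nbr tl hd k v u :=
  or_comm

theorem nbr_succ {tl hd : ℕ → ℕ} {k u v : ℕ} : Nbr tl hd (k + 1) u v ↔
    Nbr tl hd k u v ∨ (tl k = u ∧ hd k = v) ∨ (tl k = v ∧ hd k = u) := by
  simp only [Nbr, arc_succ]
  tauto

open Classical in
/-- The number of neighbours of `v` with respect to the first `k` arcs. -/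
noncomputable def nbrCount (n : ℕ) (tl hd : ℕ → ℕ) (k v : ℕ) : ℕ :=
  ((Finset.range n).filter fun w => Nbr tl hd k v w).card

-- Arcs are distinct, so arc `k` joins a new pair of neighbours unless its reverse has been read
-- before. Bidirectional edges are thereby counted once.
open Classical in
theorem ArcData.nbrCount_succ {n m : ℕ} {tl hd : ℕ → ℕ} (h : ArcData n m tl hd) {k : ℕ}
    (hk : k < m) (v : ℕ) : nbrCount n tl hd (k + 1) v = nbrCount n tl hd k v +
      if (v = tl k ∨ v = hd k) ∧ ¬ Arc tl hd k (hd k) (tl k) then 1 else 0 := by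
  have hne := h.ne k hk
  have hnot : ¬ Arc tl hd k (tl k) (hd k) := by
    rintro ⟨e, he, h1, h2⟩
    have := h.inj e (by omega) k hk h1 h2
    omega
  unfold nbrCount
  split_ifs with hc
  · obtain ⟨hv, hA⟩ := hc
    rcases hv with rfl | rfl
    · rw [← Finset.card_insert_of_notMem (a := hd k)]
      · congr 1
        ext w
        simp only [nbr_succ, Finset.mem_filter, Finset.mem_range, Finset.mem_insert]
        have := h.hd_lt k hk
        constructor
        · rintro ⟨h1, h2 | h2 | h2⟩
          · exact .inr ⟨h1, h2⟩
          · exact .inl h2.2.symm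
          · exact absurd h2.2.symm hne
        · rintro (rfl | ⟨h1, h2⟩)
          · exact ⟨this, by simp⟩
          · exact ⟨h1, .inl h2⟩
      · exact fun hm => (Finset.mem_filter.1 hm).2.elim hnot hA
    · rw [← Finset.card_insert_of_notMem (a := tl k)]
      · congr 1
        ext w
        simp only [nbr_succ, Finset.mem_filter, Finset.mem_range, Finset.mem_insert]
        have := h.tl_lt k hk
        constructor
        · rintro ⟨h1, h2 | h2 | h2⟩
          · exact .inr ⟨h1, h2⟩
          · exact absurd h2.1 hne
          · exact .inl h2.1.symm
        · rintro (rfl | ⟨h1, h2⟩)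
          · exact ⟨this, by simp⟩
          · exact ⟨h1, .inl h2⟩
      · exact fun hm => (Finset.mem_filter.1 hm).2.elim hA hnot
  · rw [add_zero]
    congr 1
    ext w
    simp only [nbr_succ, Finset.mem_filter, Finset.mem_range, and_congr_right_iff, or_iff_left_iff_imp]
    intro _
    by_cases hA : Arc tl hd k (hd k) (tl k)
    · rintro (⟨rfl, rfl⟩ | ⟨rfl, rfl⟩)
      · exact .inr hA
      · exact .inl hA
    · rintro (⟨rfl, rfl⟩ | ⟨rfl, rfl⟩)
      · exact absurd ⟨.inl rfl, hA⟩ hc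
      · exact absurd ⟨.inr rfl, hA⟩ hc

theorem nbrCount_zero {n : ℕ} {tl hd : ℕ → ℕ} {v : ℕ} : nbrCount n tl hd 0 v = 0 := by
  simp [nbrCount, Nbr, not_arc_zero]

theorem ArcData.not_nbr_self {n m : ℕ} {tl hd : ℕ → ℕ} (h : ArcData n m tl hd) (v : ℕ) :
    ¬ Nbr tl hd m v v := by
  rintro (⟨e, he, h1, h2⟩ | ⟨e, he, h1, h2⟩) <;> exact h.ne e he (h1.trans h2.symm)

theorem ArcData.nbrCount_lt {n m : ℕ} {tl hd : ℕ → ℕ} (h : ArcData n m tl hd) {v : ℕ}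
    (hv : v < n) : nbrCount n tl hd m v < n := by
  classical
  have : nbrCount n tl hd m v < (Finset.range n).card := Finset.card_lt_card <| by
    refine Finset.filter_ssubset.2 ⟨v, by simpa using hv, h.not_nbr_self v⟩
  simpa using this

theorem nbrCount_le {n k : ℕ} {tl hd : ℕ → ℕ} {v : ℕ} : nbrCount n tl hd k v ≤ n := by
  classical
  exact (Finset.card_filter_le _ _).trans (by simp)

/-- Two-dimensional addressing in a one-dimensional array, used for the adjacency matrix and for the
buckets. -/
theorem row_inj {n u v u' v' : ℕ} (hv : v < n) (hv' : v' < n) :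
    u * n + v = u' * n + v' ↔ u = u' ∧ v = v' := by
  constructor
  · intro h
    have h1 : (u * n + v) / n = u := by
      rw [mul_comm, Nat.mul_add_div (by omega), Nat.div_eq_of_lt hv, add_zero]
    have h2 : (u' * n + v') / n = u' := by
      rw [mul_comm, Nat.mul_add_div (by omega), Nat.div_eq_of_lt hv', add_zero]
    have : u = u' := by rw [← h1, ← h2, h]
    subst this
    exact ⟨rfl, by omega⟩
  · rintro ⟨rfl, rfl⟩
    rfl

theorem row_lt {n u v : ℕ} (hu : u < n) (hv : v < n) : u * n + v < n * n := by
  have : (u + 1) * n ≤ n * n := Nat.mul_le_mul_right n hu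
  rw [add_mul] at this
  omega

/-- The state `s` holds the digraph in the variables `0`, `1` and the arrays `0`, `1`, and the
constants `1` and `0` in the variables `2` and `30`. -/
structure Setup (n m : ℕ) (tl hd : ℕ → ℕ) (s : State) : Prop where
  var0 : s.var 0 = n
  var1 : s.var 1 = m
  var2 : s.var 2 = 1
  var30 : s.var 30 = 0
  arr0 : ∀ e < m, s.arr 0 e = tl e
  arr1 : ∀ e < m, s.arr 1 e = hd e

theorem Setup.frame {n m : ℕ} {tl hd : ℕ → ℕ} {s s' : State} {p : Program}
    (h : Setup n m tl hd s) (hf : Frame p s s')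
    (hp : (0 ∉ p.vars ∧ 1 ∉ p.vars ∧ 2 ∉ p.vars ∧ 30 ∉ p.vars) ∧ 0 ∉ p.arrs ∧ 1 ∉ p.arrs) :
    Setup n m tl hd s' := by
  obtain ⟨⟨h0, h1, h2, h3⟩, a0, a1⟩ := hp
  exact ⟨(hf.var _ h0).trans h.var0, (hf.var _ h1).trans h.var1, (hf.var _ h2).trans h.var2,
    (hf.var _ h3).trans h.var30, by rw [hf.arr _ a0]; exact h.arr0, by rw [hf.arr _ a1]; exact h.arr1⟩

/-- `A₂[u] := u * n` for all `u` -/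
def rowLoop : Program :=
  forLoop 3 0 (.instr (.store 2 3 5) ;; .instr (.add 5 5 0))

/-- The machine cannot multiply, so the row offsets are accumulated by addition. -/
theorem rowLoop_run {W n m : ℕ} {tl hd : ℕ → ℕ} {s : State} (hs : Setup n m tl hd s)
    (hW : n * n + n + m < W) (h5 : s.var 5 = 0) :
    Run W rowLoop s (n * 4 + 2) fun s' => ∀ u < n, s'.arr 2 u = u * n := by
  refine (Run.forLoop_wp (fun k s => s.var 5 = k * n ∧ ∀ u < k, s.arr 2 u = u * n) (by decide)
    (by decide) hs.var0 hs.var2 (by omega) (by simp [h5]) ?_).mono le_rfl fun s' h => h.2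
  rintro k hk s' hf hi ⟨h1, h2⟩
  have hs' := hs.frame hf (by decide)
  have := row_lt (n := n) (u := k) (v := 0) hk (by omega)
  simp [Program.wp, Instr.wp, hi, h1, hs'.var0]
  refine ⟨by omega, by ring, fun u hu => ?_⟩
  rcases hu.lt_or_eq with h | rfl
  · simp [h.ne, h2 u h]
  · simp

/-- The adjacency matrix in array `3` and the degrees in array `4`. -/
def degLoop : Program :=
  forLoop 3 1 (.instr (.load 4 0 3) ;; .instr (.load 5 1 3) ;; .instr (.load 6 2 4) ;;
    .instr (.load 7 2 5) ;; .instr (.add 6 6 5) ;; .instr (.add 7 7 4) ;; .instr (.store 3 6 2) ;;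
    .instr (.load 8 3 7) ;; .ite (.eq 8 2) .skip (.instr (.load 9 4 4) ;; .instr (.add 9 9 2) ;;
      .instr (.store 4 4 9) ;; .instr (.load 9 4 5) ;; .instr (.add 9 9 2) ;;
      .instr (.store 4 5 9)))

-- The matrix has `n * n` cells but is zero at the start, and only the cells named by arcs are
-- accessed, so the time is linear in `m`.
open Classical in
theorem degLoop_run {W n m : ℕ} {tl hd : ℕ → ℕ} {s : State} (hs : Setup n m tl hd s)
    (hd' : ArcData n m tl hd)
    (hW : n * n + n + m < W) (h1 : ∀ u < n, s.arr 2 u = u * n) (h3 : ∀ i, s.arr 3 i = 0)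
    (h4 : ∀ i, s.arr 4 i = 0) :
    Run W degLoop s (m * 17 + 2) fun s' => ∀ u < n, s'.arr 4 u = nbrCount n tl hd m u := by
  refine (Run.forLoop_wp (fun k s =>
    (∀ u < n, ∀ v < n, s.arr 3 (u * n + v) = if Arc tl hd k u v then 1 else 0) ∧
    ∀ u < n, s.arr 4 u = nbrCount n tl hd k u) (by decide)
    (by decide) hs.var1 hs.var2 (by omega) (by simp [h3, h4, not_arc_zero, nbrCount_zero])
    ?_).mono le_rfl fun s' h => h.2
  rintro k hk s' hf hi ⟨hM, hD⟩
  have hs' := hs.frame hf (by decide)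
  have hrow : ∀ u < n, s'.arr 2 u = u * n := by rw [hf.arr 2 (by decide)]; exact h1
  have hu := hd'.tl_lt k hk
  have hv := hd'.hd_lt k hk
  have hne := hd'.ne k hk
  have hb1 := row_lt hu hv
  have hb2 := row_lt hv hu
  have hd1 := nbrCount_le (n := n) (k := k) (tl := tl) (hd := hd) (v := tl k)
  have hd2 := nbrCount_le (n := n) (k := k) (tl := tl) (hd := hd) (v := hd k)
  -- The cell of the arc is written before the cell of the reverse arc is read; they differ since
  -- there are no loops.
  have hcoll : ¬ (hd k * n + tl k = tl k * n + hd k) := by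
    rw [row_inj hu hv]; exact fun h => hne h.2
  have hmat : ∀ u < n, ∀ v < n, Function.update (s'.arr 3) (tl k * n + hd k) 1 (u * n + v) =
      if Arc tl hd (k + 1) u v then 1 else 0 := by
    intro u hu' v hv'
    simp only [Function.update_apply, row_inj hv' hv, hM u hu' v hv', arc_succ]
    by_cases hc : u = tl k ∧ v = hd k
    · rw [if_pos hc, if_pos (.inr ⟨hc.1.symm, hc.2.symm⟩)]
    · rw [if_neg hc]
      have : ¬ (tl k = u ∧ hd k = v) := fun h => hc ⟨h.1.symm, h.2.symm⟩
      simp [this]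
  simp [Program.wp, Instr.wp, hi, hs'.var2, hs'.arr0 k hk, hs'.arr1 k hk, hrow _ hu, hrow _ hv,
    hcoll, hM _ hv _ hu, hD _ hu, hD _ hv, hne.symm]
  refine ⟨by omega, by omega, fun h => ⟨hmat, fun u hu' => ?_⟩, fun h => ⟨by omega, ?_, hmat, fun u hu' => ?_⟩⟩
  · rw [hd'.nbrCount_succ hk, hD u hu']
    simp [h]
  · omega
  · rw [hd'.nbrCount_succ hk, Function.update_apply, Function.update_apply, hD u hu']
    by_cases h1 : u = hd k
    · subst h1; simp [h]
    · by_cases h2 : u = tl k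
      · subst h2; simp [h, hne]
      · simp [h1, h2]

/-- The words `B (d * n + i)`, `i < cnt d`, are the elements of `R` of degree `d`, each listed
once. -/
structure Buckets (n : ℕ) (deg B cnt : ℕ → ℕ) (R : Finset ℕ) : Prop where
  card : ∀ d < n, cnt d = (R.filter fun v => deg v = d).card
  image : ∀ d < n, (Finset.range (cnt d)).image (fun i => B (d * n + i)) =
    R.filter fun v => deg v = d

theorem Buckets.cnt_le {n : ℕ} {deg B cnt : ℕ → ℕ} {R : Finset ℕ} (h : Buckets n deg B cnt R)
    (hR : R ⊆ Finset.range n) {d : ℕ} (hd : d < n) : cnt d ≤ n := by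
  rw [h.card d hd]
  exact (Finset.card_le_card ((Finset.filter_subset _ _).trans hR)).trans (by simp)

/-- Since `v` is not yet listed, its bucket has fewer than `n` entries. The new entry stays within
its row and overwrites nothing in another bucket. -/
theorem Buckets.push {n : ℕ} {deg B cnt : ℕ → ℕ} {R : Finset ℕ} (h : Buckets n deg B cnt R)
    (hR : R ⊆ Finset.range n) {v : ℕ} (hv : v < n) (hvR : v ∉ R) (hdeg : deg v < n) :
    cnt (deg v) < n ∧ Buckets n deg (Function.update B (deg v * n + cnt (deg v)) v)
      (Function.update cnt (deg v) (cnt (deg v) + 1)) (insert v R) := by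
  have hlt : ∀ d < n, cnt d < n := fun d hd => by
    rw [h.card d hd]
    have : (R.filter fun v => deg v = d) ⊂ Finset.range n :=
      ((Finset.filter_subset _ _).trans hR).ssubset_of_mem_notMem (Finset.mem_range.2 hv)
        (by simp [hvR])
    simpa using Finset.card_lt_card this
  refine ⟨hlt _ hdeg, fun d hd => ?_, fun d hd => ?_⟩
  · rw [Finset.filter_insert, Function.update_apply]
    by_cases hc : d = deg v
    · subst hc
      rw [if_pos rfl, if_pos rfl, Finset.card_insert_of_notMem (by simp [hvR]), h.card _ hd]
    · rw [if_neg hc, if_neg (Ne.symm hc), h.card _ hd]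
  · rw [Finset.filter_insert, Function.update_apply, ← h.image d hd]
    by_cases hc : d = deg v
    · subst hc
      rw [if_pos rfl, if_pos rfl, Finset.range_add_one, Finset.image_insert,
        Function.update_self]
      congr 1
      refine Finset.image_congr fun i hi => ?_
      have : i < cnt (deg v) := by simpa using hi
      exact Function.update_of_ne (by omega) _ _
    · rw [if_neg hc, if_neg (Ne.symm hc)]
      refine Finset.image_congr fun i hi => ?_
      have hi' : i < cnt d := by simpa using hi
      refine Function.update_of_ne (fun he => hc ?_) _ _
      exact ((row_inj (hi'.trans (hlt d hd)) (hlt _ hdeg)).1 he).1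

theorem Buckets.pop {n : ℕ} {deg B cnt : ℕ → ℕ} {R : Finset ℕ} (h : Buckets n deg B cnt R)
    {d : ℕ} (hd : d < n) (hc : cnt d ≠ 0) :
    B (d * n + (cnt d - 1)) ∈ R ∧ deg (B (d * n + (cnt d - 1))) = d ∧
      Buckets n deg B (Function.update cnt d (cnt d - 1))
        (R.erase (B (d * n + (cnt d - 1)))) := by
  obtain ⟨c, hc⟩ := Nat.exists_eq_succ_of_ne_zero hc
  have hi := h.image d hd
  have hk := h.card d hd
  rw [hc, Nat.succ_eq_add_one, Finset.range_add_one, Finset.image_insert] at hi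
  rw [hc, Nat.succ_eq_add_one] at hk
  simp only [hc, Nat.succ_eq_add_one, Nat.add_sub_cancel]
  set v := B (d * n + c)
  have hv : v ∈ R.filter fun v => deg v = d := by rw [← hi]; simp
  obtain ⟨hv1, hv2⟩ := Finset.mem_filter.1 hv
  -- The first `c` entries give at most `c` vertices while the bucket contains `c + 1`, so the last
  -- entry does not occur earlier.
  have hni : v ∉ (Finset.range c).image fun i => B (d * n + i) := fun hm => by
    rw [Finset.insert_eq_of_mem hm] at hi
    have := Finset.card_image_le (s := Finset.range c) (f := fun i => B (d * n + i))
    rw [hi, Finset.card_range] at this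
    omega
  refine ⟨hv1, hv2, fun e he => ?_, fun e he => ?_⟩
  · rw [Finset.filter_erase, Function.update_apply]
    by_cases hed : e = d
    · subst hed
      rw [if_pos rfl, Finset.card_erase_of_mem hv, ← hk, Nat.add_sub_cancel]
    · rw [if_neg hed, Finset.erase_eq_of_notMem, h.card e he]
      simp only [Finset.mem_filter, not_and]
      exact fun _ h => hed (h.symm.trans hv2)
  · rw [Finset.filter_erase, Function.update_apply]
    by_cases hed : e = d
    · subst hed
      rw [if_pos rfl, ← hi, Finset.erase_insert hni]
    · rw [if_neg hed, Finset.erase_eq_of_notMem, h.image e he]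
      simp only [Finset.mem_filter, not_and]
      exact fun _ h => hed (h.symm.trans hv2)

/-- The vertices are put into buckets according to their degrees. -/
def bucketLoop : Program :=
  forLoop 3 0 (.instr (.load 4 4 3) ;; .instr (.load 5 6 4) ;; .instr (.load 6 2 4) ;;
    .instr (.add 6 6 5) ;; .instr (.store 5 6 3) ;; .instr (.add 5 5 2) ;; .instr (.store 6 4 5))

theorem bucketLoop_run {W n m : ℕ} {tl hd : ℕ → ℕ} {s : State} (hs : Setup n m tl hd s)
    (hW : n * n + n + m < W) (h1 : ∀ u < n, s.arr 2 u = u * n) (deg : ℕ → ℕ)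
    (hdeg : ∀ u < n, deg u < n) (h4 : ∀ u < n, s.arr 4 u = deg u) (h6 : ∀ i, s.arr 6 i = 0) :
    Run W bucketLoop s (n * 9 + 2) fun s' =>
      Buckets n deg (s'.arr 5) (s'.arr 6) (Finset.range n) := by
  refine (Run.forLoop_wp (fun k s => Buckets n deg (s.arr 5) (s.arr 6) (Finset.range k))
    (by decide) (by decide) hs.var0 hs.var2 (by omega) ⟨by simp [h6], by simp [h6]⟩
    ?_).mono le_rfl fun s' h => h
  intro k hk s' hf hi hB
  have hs' := hs.frame hf (by decide)
  have hrow : ∀ u < n, s'.arr 2 u = u * n := by rw [hf.arr 2 (by decide)]; exact h1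
  have hd4 : ∀ u < n, s'.arr 4 u = deg u := by rw [hf.arr 4 (by decide)]; exact h4
  obtain ⟨hlt, hB'⟩ := hB.push (by simpa using hk.le) hk (by simp) (hdeg k hk)
  have := row_lt (hdeg k hk) hlt
  rw [← Finset.range_add_one] at hB'
  simp [Program.wp, Instr.wp, hi, hs'.var2, hrow _ (hdeg k hk), hd4 k hk]
  exact ⟨by omega, by omega, hB'⟩

end RAM

/-! ### Elimination of dominating and isolated vertices. -/

namespace RAM

open Classical in
/-- The state of the elimination of dominating and isolated vertices, when the `r` vertices in `R`
are left and `D` dominating vertices have been removed. The removed vertices have got the positions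
`r, …, n - 1` (`ord` and `pos` are inverse to each other), `dom` marks the dominating ones among
them, and `f` is the position at those that are not dominating, and `0` elsewhere. -/
structure Peeled (n : ℕ) (N : ℕ → ℕ → Prop) (deg : ℕ → ℕ) (r : ℕ) (R : Finset ℕ) (D : ℕ)
    (ord pos dom f : ℕ → ℕ) : Prop where
  sub : R ⊆ Finset.range n
  card : R.card = r
  le : D + r ≤ n
  deg_eq : ∀ v ∈ R, deg v = D + (R.filter (N v)).card
  pos_lt : ∀ v < n, v ∉ R → r ≤ pos v ∧ pos v < n
  ord_pos : ∀ v < n, v ∉ R → ord (pos v) = v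
  pos_ord : ∀ p < n, r ≤ p → ord p < n ∧ ord p ∉ R ∧ pos (ord p) = p
  adj_iff : ∀ v < n, v ∉ R → ∀ u < n, u ≠ v → u ∈ R ∨ pos u < pos v → (N v u ↔ dom v = 1)
  f_mem : ∀ v ∈ R, f v = 0
  f_notMem : ∀ v < n, v ∉ R → f v = if dom v = 1 then 0 else pos v
  first : ∀ v < n, v ∉ R → pos v = 0 → dom v = 1

/-- The removed vertex is adjacent to all remaining ones (`a = 1`) or to none (`a = 0`), so every
degree within the remaining set drops by exactly `a`. Adding `a` to `D` compensates for this, and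
`deg` needs no update. -/
theorem Peeled.step {n : ℕ} {N : ℕ → ℕ → Prop} {deg : ℕ → ℕ} {r : ℕ} {R : Finset ℕ} {D : ℕ}
    {ord pos dom f : ℕ → ℕ} (h : Peeled n N deg (r + 1) R D ord pos dom f)
    (hN : ∀ u v, N u v → N v u) {v a : ℕ} (hv : v ∈ R) (ha : a ≤ 1)
    (hva : ∀ u ∈ R, u ≠ v → (N v u ↔ a = 1)) (h0 : r = 0 → a = 1) :
    Peeled n N deg r (R.erase v) (D + a) (Function.update ord r v) (Function.update pos v r)
      (Function.update dom v a) (if a = 1 then f else Function.update f v r) := by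
  classical
  have hvn : v < n := by simpa using h.sub hv
  have hcases : ∀ w < n, w ∉ R.erase v → w ≠ v → w ∉ R := fun w _ hw hne hm =>
    hw (Finset.mem_erase.2 ⟨hne, hm⟩)
  have hle := h.le
  refine ⟨(Finset.erase_subset _ _).trans h.sub, ?_, by omega, ?_, ?_, ?_, ?_, ?_, ?_, ?_, ?_⟩
  · rw [Finset.card_erase_of_mem hv, h.card, Nat.add_sub_cancel]
  · intro u hu
    obtain ⟨hne, hu⟩ := Finset.mem_erase.1 hu
    rw [h.deg_eq u hu, Finset.filter_erase]
    by_cases hc : N u v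
    · have : a = 1 := (hva u hu hne).1 (hN _ _ hc)
      rw [Finset.card_erase_of_mem (Finset.mem_filter.2 ⟨hv, hc⟩)]
      have : 0 < (R.filter (N u)).card := Finset.card_pos.2 ⟨v, Finset.mem_filter.2 ⟨hv, hc⟩⟩
      omega
    · have : a ≠ 1 := fun h => hc (hN _ _ ((hva u hu hne).2 h))
      rw [Finset.erase_eq_of_notMem fun hm => hc (Finset.mem_filter.1 hm).2]
      omega
  · intro w hw hwR
    rw [Function.update_apply]
    split_ifs with hc
    · omega
    · have := h.pos_lt w hw (hcases w hw hwR hc)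
      omega
  · intro w hw hwR
    by_cases hc : w = v
    · subst hc
      simp
    · rw [Function.update_of_ne hc]
      have := h.pos_lt w hw (hcases w hw hwR hc)
      rw [Function.update_of_ne (by omega)]
      exact h.ord_pos w hw (hcases w hw hwR hc)
  · intro p hp hrp
    by_cases hc : p = r
    · subst hc
      simp [hvn]
    · obtain ⟨h1, h2, h3⟩ := h.pos_ord p hp (by omega)
      rw [Function.update_of_ne hc]
      refine ⟨h1, fun hm => h2 (Finset.mem_of_mem_erase hm), ?_⟩
      rw [Function.update_of_ne, h3]
      rintro rfl
      exact h2 hv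
  · intro w hw hwR u hu hne huw
    by_cases hc : w = v
    · subst hc
      rw [Function.update_self, Function.update_of_ne hne] at *
      refine hva u ?_ hne
      rcases huw with huw | huw
      · exact Finset.mem_of_mem_erase huw
      · by_contra huR
        have := h.pos_lt u hu huR
        omega
    · rw [Function.update_of_ne hc]
      refine h.adj_iff w hw (hcases w hw hwR hc) u hu hne ?_
      rcases huw with huw | huw
      · exact .inl (Finset.mem_of_mem_erase huw)
      · by_cases huv : u = v
        · subst huv
          exact .inl hv
        · rw [Function.update_of_ne huv, Function.update_of_ne hc] at huw
          exact .inr huw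
  · intro w hw
    obtain ⟨hne, hw⟩ := Finset.mem_erase.1 hw
    split_ifs
    · exact h.f_mem w hw
    · rw [Function.update_of_ne hne, h.f_mem w hw]
  · intro w hw hwR
    by_cases hc : w = v
    · subst hc
      simp only [Function.update_self]
      split_ifs
      · exact h.f_mem w hv
      · simp
    · rw [Function.update_of_ne hc, Function.update_of_ne hc,
        ← h.f_notMem w hw (hcases w hw hwR hc)]
      split_ifs
      · rfl
      · rw [Function.update_of_ne hc]
  · intro w hw hwR hp
    by_cases hc : w = v
    · subst hc
      rw [Function.update_self] at *
      exact h0 hp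
    · rw [Function.update_of_ne hc] at *
      exact h.first w hw (hcases w hw hwR hc) hp

/-- By `deg_eq`, the degree exceeds `D` by the number of neighbours among the `r` other remaining
vertices; it equals `D + r` only if all of them are neighbours. -/
theorem Peeled.dominating {n : ℕ} {N : ℕ → ℕ → Prop} {deg : ℕ → ℕ} {r : ℕ} {R : Finset ℕ} {D : ℕ}
    {ord pos dom f : ℕ → ℕ} (h : Peeled n N deg (r + 1) R D ord pos dom f)
    (hirr : ∀ u, ¬ N u u) {v : ℕ} (hv : v ∈ R) : deg v = D + r ↔ ∀ u ∈ R, u ≠ v → N v u := by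
  classical
  have h1 := h.deg_eq v hv
  have hsub : R.filter (N v) ⊆ R.erase v := fun u hu => by
    obtain ⟨h1, h2⟩ := Finset.mem_filter.1 hu
    exact Finset.mem_erase.2 ⟨by rintro rfl; exact hirr _ h2, h1⟩
  have hcard : (R.erase v).card = r := by
    rw [Finset.card_erase_of_mem hv, h.card, Nat.add_sub_cancel]
  constructor
  · intro hd u hu hne
    have := Finset.eq_of_subset_of_card_le hsub (by omega)
    have hm : u ∈ R.filter (N v) := by rw [this]; exact Finset.mem_erase.2 ⟨hne, hu⟩
    exact (Finset.mem_filter.1 hm).2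
  · intro hu
    rw [h1, ← hcard]
    congr 2
    refine hsub.antisymm fun w hw => ?_
    obtain ⟨h1, h2⟩ := Finset.mem_erase.1 hw
    exact Finset.mem_filter.2 ⟨h2, hu w h2 h1⟩

theorem Peeled.isolated {n : ℕ} {N : ℕ → ℕ → Prop} {deg : ℕ → ℕ} {r : ℕ} {R : Finset ℕ} {D : ℕ}
    {ord pos dom f : ℕ → ℕ} (h : Peeled n N deg r R D ord pos dom f)
    {v : ℕ} (hv : v ∈ R) : deg v = D ↔ ∀ u ∈ R, ¬ N v u := by
  classical
  rw [h.deg_eq v hv, add_eq_left, Finset.card_eq_zero, Finset.filter_eq_empty_iff]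

/-- Every nonempty set of vertices has a vertex that is adjacent to all, or to none, of the
others. -/
def HasExtremal (n : ℕ) (N : ℕ → ℕ → Prop) : Prop :=
  ∀ R ⊆ Finset.range n, R.Nonempty →
    ∃ v ∈ R, (∀ u ∈ R, u ≠ v → N v u) ∨ (∀ u ∈ R, ¬ N v u)

/-- The elimination of dominating and isolated vertices. -/
def peelLoop : Program :=
  .instr (.move 4 0) ;; .instr (.const 5 0) ;;
  forLoop 3 0 (.instr (.sub 4 4 2) ;; .instr (.add 6 5 4) ;; .instr (.load 7 6 6) ;;
    .ite (.eq 7 30) (.instr (.load 7 6 5) ;; .instr (.move 6 5) ;; .instr (.const 8 0))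
      (.instr (.add 5 5 2) ;; .instr (.const 8 1)) ;;
    .instr (.sub 7 7 2) ;; .instr (.store 6 6 7) ;; .instr (.load 9 2 6) ;;
    .instr (.add 9 9 7) ;; .instr (.load 9 5 9) ;; .instr (.store 7 4 9) ;;
    .instr (.store 8 9 4) ;; .instr (.store 9 9 8) ;;
    .ite (.eq 8 2) .skip (.instr (.store 10 9 4)))

/-- Bucket `D + r` is tried first. If it is empty, no remaining vertex is dominating, so
`HasExtremal` provides an isolated one and bucket `D` is nonempty. Each removal takes constant time.
-/
theorem peelLoop_run {W n m : ℕ} {tl hd : ℕ → ℕ} {s : State} (hs : Setup n m tl hd s)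
    (hW : n * n + n + m < W) (h1 : ∀ u < n, s.arr 2 u = u * n) (N : ℕ → ℕ → Prop)
    (hN : ∀ u v, N u v → N v u) (hirr : ∀ u, ¬ N u u) (hex : HasExtremal n N) (deg : ℕ → ℕ)
    (hdeg : ∀ v < n, deg v = by classical exact ((Finset.range n).filter (N v)).card)
    (hB : Buckets n deg (s.arr 5) (s.arr 6) (Finset.range n)) (h10 : ∀ i, s.arr 10 i = 0) :
    Run W peelLoop s (1 + (1 + (n * 19 + 2))) fun s' =>
      Peeled n N deg 0 ∅ (s'.var 5) (s'.arr 7) (s'.arr 8) (s'.arr 9) (s'.arr 10) := by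
  classical
  refine Run.seq (Run.of_wp ?_)
  -- The weakest precondition of a single instruction unfolds to the `Run` goal for the rest,
  -- started in the updated state.
  change Run _ _ _ _ _
  refine Run.seq (Run.of_wp ⟨by omega, ?_⟩)
  set s₀ := (s.setVar 4 (s.var 0)).setVar 5 0 with hs₀
  have hs₀' : Setup n m tl hd s₀ :=
    ⟨hs.var0, hs.var1, hs.var2, hs.var30, hs.arr0, hs.arr1⟩
  have harr : s₀.arr = s.arr := rfl
  refine (Run.forLoop_wp (fun k s => s.var 4 = n - k ∧ ∃ R,
      Buckets n deg (s.arr 5) (s.arr 6) R ∧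
      Peeled n N deg (n - k) R (s.var 5) (s.arr 7) (s.arr 8) (s.arr 9) (s.arr 10))
    (by decide) (by decide) hs₀'.var0 hs₀'.var2 (by omega) ?_
    ?_).mono le_rfl ?_
  · refine ⟨by simp [hs₀, hs.var0], Finset.range n, hB, subset_rfl, by simp, by simp [hs₀], ?_, ?_,
      ?_, ?_, ?_, ?_, ?_, ?_⟩
    · intro v hv
      rw [hdeg v (by simpa using hv)]
      simp [hs₀]
    · exact fun v hv hv' => absurd (Finset.mem_range.2 hv) hv'
    · exact fun v hv hv' => absurd (Finset.mem_range.2 hv) hv'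
    · intro p hp hp'
      omega
    · exact fun v hv hv' => absurd (Finset.mem_range.2 hv) hv'
    · intro v hv
      exact h10 v
    · exact fun v hv hv' => absurd (Finset.mem_range.2 hv) hv'
    · exact fun v hv hv' => absurd (Finset.mem_range.2 hv) hv'
  · rintro k hk s' hf hi ⟨h4, R, hBk, hP⟩
    have hs' := hs₀'.frame hf (by decide)
    have hrow : ∀ u < n, s'.arr 2 u = u * n := by rw [hf.arr 2 (by decide), harr]; exact h1
    obtain ⟨r, hr⟩ : ∃ r, n - k = r + 1 := ⟨n - k - 1, by omega⟩
    have hr' : n - (k + 1) = r := by omega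
    rw [hr] at hP h4
    have hle := hP.le
    have hD := fun v => hP.dominating hirr (v := v)
    have hI := fun v => hP.isolated (v := v)
    generalize hvD : s'.var 5 = D at *
    have hlt : D + r < n := by omega
    -- the common end of both branches
    have tail : ∀ d a, d < n → a ≤ 1 → s'.arr 6 d ≠ 0 →
        (∀ v ∈ R, deg v = d → ∀ u ∈ R, u ≠ v → (N v u ↔ a = 1)) → (r = 0 → a = 1) →
        d * n + (s'.arr 6 d - 1) < W ∧
        ∃ R', Buckets n deg (s'.arr 5) (Function.update (s'.arr 6) d (s'.arr 6 d - 1)) R' ∧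
          Peeled n N deg r R' (D + a)
            (Function.update (s'.arr 7) r (s'.arr 5 (d * n + (s'.arr 6 d - 1))))
            (Function.update (s'.arr 8) (s'.arr 5 (d * n + (s'.arr 6 d - 1))) r)
            (Function.update (s'.arr 9) (s'.arr 5 (d * n + (s'.arr 6 d - 1))) a)
            (if a = 1 then s'.arr 10 else
              Function.update (s'.arr 10) (s'.arr 5 (d * n + (s'.arr 6 d - 1))) r) := by
      intro d a hd ha hc hva hr0
      obtain ⟨hv, hvd, hB'⟩ := hBk.pop hd hc
      have hcn := hBk.cnt_le hP.sub hd
      have := row_lt (v := s'.arr 6 d - 1) hd (by omega)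
      exact ⟨by omega, _, hB', hP.step hN hv ha (hva _ hv hvd) hr0⟩
    simp [Program.wp, Instr.wp, h4, hs'.var2, hs'.var30, hr', hvD]
    refine ⟨by omega, fun hc => ⟨by omega, ?_⟩, fun hc => ⟨by omega, by omega, ?_⟩⟩
    · have hno : ∀ v ∈ R, deg v ≠ D + r := by
        rw [hBk.card _ hlt, Finset.card_eq_zero, Finset.filter_eq_empty_iff] at hc
        exact fun v hv => hc hv
      have hRne : R.Nonempty := Finset.card_pos.1 (by rw [hP.card]; omega)
      have hc0 : s'.arr 6 D ≠ 0 := by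
        rw [hBk.card _ (by omega), Finset.card_ne_zero]
        obtain ⟨v, hv, h | h⟩ := hex R hP.sub hRne
        · exact absurd ((hD v hv).2 h) (hno v hv)
        · exact ⟨v, Finset.mem_filter.2 ⟨hv, (hI v hv).2 h⟩⟩
      -- For a single remaining vertex both buckets coincide, so the isolated case does not occur
      -- then; this is why position `0` is marked as dominating.
      have hr0 : r ≠ 0 := by
        rintro rfl
        exact hc0 hc
      have := tail D 0 (by omega) (by omega) hc0
        (fun v hv hvd u hu _ => by simpa using (hI v hv).1 hvd u hu) (fun h => absurd h hr0)
      simpa [hrow D (by omega)] using this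
    · have := tail (D + r) 1 (by omega) (by omega) hc
        (fun v hv hvd u hu hne => by simpa using (hD v hv).1 hvd u hu hne) (fun _ => rfl)
      simpa [hrow _ hlt] using this
  · rintro s' ⟨-, R, -, hP⟩
    have : R = ∅ := by
      have := hP.card
      rwa [Nat.sub_self, Finset.card_eq_zero] at this
    subst this
    simpa using hP

end RAM

/-! ### Testing all candidates in linear time. -/

namespace RAM

/-- `A₁₀[u]` becomes the largest position of a non-dominating vertex in the closed
out-neighbourhood of `u`, or `0` if there is none. -/
def reachLoop : Program :=
  forLoop 3 1 (.instr (.load 4 0 3) ;; .instr (.load 5 1 3) ;; .instr (.load 6 9 5) ;;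
    .ite (.eq 6 2) .skip (.instr (.load 6 8 5) ;; .instr (.load 7 10 4) ;;
      .ite (.lt 7 6) (.instr (.store 10 4 6)) .skip))

/-- The maximum is described by the numbers `j` below it. In this form the default `0` is harmless,
and the statement says directly whether `u` is in, or has an arc to, the part of a candidate after
position `j`. The initial values account for `u` itself. -/
theorem reachLoop_run {W n m : ℕ} {tl hd : ℕ → ℕ} {s : State} (hs : Setup n m tl hd s)
    (hW : n * n + n + m < W)
    (h10 : ∀ v < n, s.arr 10 v = if s.arr 9 v = 1 then 0 else s.arr 8 v)
    (hhd : ∀ e < m, hd e < n) :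
    Run W reachLoop s (m * 10 + 2) fun s' => ∀ u < n, ∀ j, j < s'.arr 10 u ↔
      ∃ w < n, s.arr 9 w ≠ 1 ∧ j < s.arr 8 w ∧ (w = u ∨ Arc tl hd m u w) := by
  refine (Run.forLoop_wp (fun k s' => ∀ u < n, ∀ j, j < s'.arr 10 u ↔
      ∃ w < n, s.arr 9 w ≠ 1 ∧ j < s.arr 8 w ∧ (w = u ∨ Arc tl hd k u w)) (by decide)
    (by decide) hs.var1 hs.var2 (by omega) ?_ ?_).mono le_rfl fun s' h => h
  · intro u hu j
    rw [State.arr_setVar, h10 u hu]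
    simp only [not_arc_zero, or_false]
    constructor
    · intro h
      split_ifs at h with hc
      · omega
      · exact ⟨u, hu, hc, h, rfl⟩
    · rintro ⟨w, hw, h1, h2, rfl⟩
      rwa [if_neg h1]
  · intro k hk s' hf hi hI
    have hs' := hs.frame hf (by decide)
    have h9 : s'.arr 9 = s.arr 9 := hf.arr 9 (by decide)
    have h8 : s'.arr 8 = s.arr 8 := hf.arr 8 (by decide)
    have hk' := hhd k hk
    simp [Program.wp, Instr.wp, hi, hs'.var2, hs'.arr0 k hk, hs'.arr1 k hk, h9, h8]
    have old : ∀ u < n, ∀ j, (∃ w < n, s.arr 9 w ≠ 1 ∧ j < s.arr 8 w ∧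
        (w = u ∨ Arc tl hd (k + 1) u w)) ↔ (j < s'.arr 10 u ∨
          (s.arr 9 (hd k) ≠ 1 ∧ j < s.arr 8 (hd k) ∧ tl k = u)) := by
      intro u hu j
      rw [hI u hu j]
      simp only [arc_succ]
      constructor
      · rintro ⟨w, hw, h1, h2, h | h | ⟨h, rfl⟩⟩
        · exact .inl ⟨w, hw, h1, h2, .inl h⟩
        · exact .inl ⟨w, hw, h1, h2, .inr h⟩
        · exact .inr ⟨h1, h2, h⟩
      · rintro (⟨w, hw, h1, h2, h | h⟩ | ⟨h1, h2, h⟩)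
        · exact ⟨w, hw, h1, h2, .inl h⟩
        · exact ⟨w, hw, h1, h2, .inr (.inl h)⟩
        · exact ⟨hd k, hk', h1, h2, .inr (.inr ⟨h, rfl⟩)⟩
    refine ⟨fun hc u hu j => ?_, fun hc => ⟨fun hlt u hu j => ?_, fun hle u hu j => ?_⟩⟩
    · rw [old u hu j]
      simp [hc]
    · rw [old u hu j, Function.update_apply]
      split_ifs with h
      · subst h
        have : j < s'.arr 10 (tl k) → j < s.arr 8 (hd k) := fun h => h.trans hlt
        tauto
      · simp [Ne.symm h]
    · rw [old u hu j]
      constructor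
      · exact .inl
      · rintro (h | ⟨-, h, rfl⟩)
        · exact h
        · omega

/-- `A₁₁[d]` becomes the number of vertices `v` with `A₁₀[v] = d`. -/
def countLoop : Program :=
  forLoop 3 0 (.instr (.load 4 10 3) ;; .instr (.load 5 11 4) ;; .instr (.add 5 5 2) ;;
    .instr (.store 11 4 5))

theorem card_filter_range_succ (p : ℕ → Prop) [DecidablePred p] (k : ℕ) :
    ((Finset.range (k + 1)).filter p).card =
      ((Finset.range k).filter p).card + if p k then 1 else 0 := by
  rw [Finset.range_add_one, Finset.filter_insert]
  split_ifs with h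
  · rw [Finset.card_insert_of_notMem (by simp)]
  · rfl

theorem card_filter_range_le (p : ℕ → Prop) [DecidablePred p] (k : ℕ) :
    ((Finset.range k).filter p).card ≤ k :=
  (Finset.card_filter_le _ _).trans (by simp)

theorem countLoop_run {W n m : ℕ} {tl hd : ℕ → ℕ} {s : State} (hs : Setup n m tl hd s)
    (hW : n * n + n + m < W) (h11 : ∀ i, s.arr 11 i = 0) :
    Run W countLoop s (n * 6 + 2) fun s' => ∀ d, s'.arr 11 d =
      ((Finset.range n).filter fun v => s.arr 10 v = d).card := by
  refine (Run.forLoop_wp (fun k s' => ∀ d, s'.arr 11 d =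
      ((Finset.range k).filter fun v => s.arr 10 v = d).card) (by decide)
    (by decide) hs.var0 hs.var2 (by omega) (by simp [h11]) ?_).mono le_rfl fun s' h => h
  intro k hk s' hf hi hI
  have hs' := hs.frame hf (by decide)
  have h10 : s'.arr 10 = s.arr 10 := hf.arr 10 (by decide)
  simp [Program.wp, Instr.wp, hi, hs'.var2, h10, hI, card_filter_range_succ]
  have := card_filter_range_le (fun v => s.arr 10 v = s.arr 10 k) k
  refine ⟨by omega, fun d => ?_⟩
  rw [Function.update_apply]
  split_ifs with h1 h2 h2
  · rw [h1]
  · exact absurd h1.symm h2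
  · exact absurd h2.symm h1
  · rw [hI, add_zero]

/-- `A₁₂[p]` becomes the number of arcs `(u, w)` with `w` at position `p` and `A₁₀[u] ≤ p`. -/
def absorbLoop : Program :=
  forLoop 3 1 (.instr (.load 4 0 3) ;; .instr (.load 5 1 3) ;; .instr (.load 6 8 5) ;;
    .instr (.load 7 10 4) ;; .ite (.lt 6 7) .skip (.instr (.load 8 12 6) ;; .instr (.add 8 8 2) ;;
      .instr (.store 12 6 8)))

/-- The restriction on `A₁₀` leaves out the tails that are already taken care of by later vertices,
so that the count can be compared with the number of vertices still to be absorbed. -/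
theorem absorbLoop_run {W n m : ℕ} {tl hd : ℕ → ℕ} {s : State} (hs : Setup n m tl hd s)
    (hW : n * n + n + m < W) (h12 : ∀ i, s.arr 12 i = 0) :
    Run W absorbLoop s (m * 10 + 2) fun s' => ∀ p, s'.arr 12 p =
      ((Finset.range m).filter fun e => s.arr 8 (hd e) = p ∧ s.arr 10 (tl e) ≤ p).card := by
  refine (Run.forLoop_wp (fun k s' => ∀ p, s'.arr 12 p =
      ((Finset.range k).filter fun e => s.arr 8 (hd e) = p ∧ s.arr 10 (tl e) ≤ p).card) (by decide)
    (by decide) hs.var1 hs.var2 (by omega) (by simp [h12]) ?_).mono le_rfl fun s' h => h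
  intro k hk s' hf hi hI
  have hs' := hs.frame hf (by decide)
  have h10 : s'.arr 10 = s.arr 10 := hf.arr 10 (by decide)
  have h8 : s'.arr 8 = s.arr 8 := hf.arr 8 (by decide)
  simp [Program.wp, Instr.wp, hi, hs'.var2, hs'.arr0 k hk, hs'.arr1 k hk, h10, h8, hI,
    card_filter_range_succ]
  have := card_filter_range_le
    (fun e => s.arr 8 (hd e) = s.arr 8 (hd k) ∧ s.arr 10 (tl e) ≤ s.arr 8 (hd k)) k
  refine fun h => ⟨by omega, fun p => ?_⟩
  rw [Function.update_apply]
  split_ifs with h1 h2 h2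
  · rw [h1]
  · exact absurd ⟨h1.symm, h1 ▸ h⟩ h2
  · exact absurd h2.1.symm h1
  · rw [hI, add_zero]

/-- `A₁₃` marks the positions of the dominating vertices that yield kernels. -/
def validLoop : Program :=
  .instr (.const 5 0) ;;
  forLoop 3 0 (.instr (.load 4 11 3) ;; .instr (.add 5 5 4) ;; .instr (.load 6 7 3) ;;
    .instr (.load 7 9 6) ;; .instr (.load 8 12 3) ;; .instr (.add 8 8 2) ;;
    .ite (.eq 7 2) (.ite (.eq 8 5) (.instr (.store 13 3 2)) .skip) .skip)

/-- Variable `5` holds prefix sums of the histogram: after the addition in round `k` it is the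
number of vertices with `A₁₀` at most `k`, ready for comparison at position `k`. -/
theorem validLoop_run {W n m : ℕ} {tl hd : ℕ → ℕ} {s : State} (hs : Setup n m tl hd s)
    (hW : n * n + n + m + 1 < W) (h12 : ∀ i, s.arr 12 i ≤ m) (h13 : ∀ i, s.arr 13 i = 0)
    (h11 : ∀ d, s.arr 11 d = ((Finset.range n).filter fun v => s.arr 10 v = d).card) :
    Run W validLoop s (1 + (n * 11 + 2)) fun s' => ∀ j, s'.arr 13 j = 1 ↔
      j < n ∧ s.arr 9 (s.arr 7 j) = 1 ∧
      s.arr 12 j + 1 = ((Finset.range n).filter fun v => s.arr 10 v ≤ j).card := by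
  refine Run.seq (Run.of_wp ⟨by omega, ?_⟩)
  set s₀ := s.setVar 5 0 with hs₀
  have hs₀' : Setup n m tl hd s₀ :=
    ⟨hs.var0, hs.var1, hs.var2, hs.var30, hs.arr0, hs.arr1⟩
  refine (Run.forLoop_wp (fun k s' => s'.var 5 =
      ((Finset.range n).filter fun v => s.arr 10 v < k).card ∧ ∀ j, s'.arr 13 j = 1 ↔
      j < k ∧ s.arr 9 (s.arr 7 j) = 1 ∧
      s.arr 12 j + 1 = ((Finset.range n).filter fun v => s.arr 10 v ≤ j).card) (by decide)
    (by decide) hs₀'.var0 hs₀'.var2 (by omega) (by simp [hs₀, h13]) ?_).mono le_rfl fun s' h => h.2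
  rintro k hk s' hf hi ⟨hA, hI⟩
  have hs' := hs₀'.frame hf (by decide)
  have a7 : s'.arr 7 = s.arr 7 := hf.arr 7 (by decide)
  have a9 : s'.arr 9 = s.arr 9 := hf.arr 9 (by decide)
  have a11 : s'.arr 11 = s.arr 11 := hf.arr 11 (by decide)
  have a12 : s'.arr 12 = s.arr 12 := hf.arr 12 (by decide)
  have hsum : ((Finset.range n).filter fun v => s.arr 10 v < k).card +
      ((Finset.range n).filter fun v => s.arr 10 v = k).card =
      ((Finset.range n).filter fun v => s.arr 10 v ≤ k).card := by
    rw [← Finset.card_union_of_disjoint, ← Finset.filter_or]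
    · simp only [le_iff_lt_or_eq]
    · rw [Finset.disjoint_filter]
      intro v _ h
      omega
  have hle := card_filter_range_le (fun v => s.arr 10 v ≤ k) n
  have h12k := h12 k
  simp [Program.wp, Instr.wp, hi, hs'.var2, a7, a9, a11, a12, hA, h11, hsum]
  have hj : ∀ j, j ≠ k → (j < k + 1 ↔ j < k) := fun j hj => by omega
  refine ⟨by omega, by omega, fun h9 => ⟨fun hc j => ?_, fun hc j => ?_⟩, fun h9 j => ?_⟩
  · by_cases hjk : j = k
    · subst hjk
      simp [h9, hc]
    · rw [Function.update_of_ne hjk, hI, ← Nat.lt_succ_iff, hj j hjk]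
  · by_cases hjk : j = k
    · subst hjk
      simp [h9, hc, hI]
    · rw [hI, ← Nat.lt_succ_iff, hj j hjk]
  · by_cases hjk : j = k
    · subst hjk
      simp [h9, hI]
    · rw [hI, ← Nat.lt_succ_iff, hj j hjk]

end RAM

/-! ### Correctness of the preparatory phase. -/

namespace RAM

/-- The result of the preparatory phase: `ord` and `pos` are inverse to each other and describe a
construction sequence, `dom` marks the vertices that dominate the earlier ones, and `val` marks the
positions of the dominating vertices `c` such that each vertex equals or has an arc to `c` or a later
vertex that is not dominating. -/
structure Prepared (n m : ℕ) (tl hd ord pos dom val : ℕ → ℕ) : Prop where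
  pos_lt : ∀ v < n, pos v < n
  ord_pos : ∀ v < n, ord (pos v) = v
  ord_lt : ∀ p < n, ord p < n
  pos_ord : ∀ p < n, pos (ord p) = p
  adj_iff : ∀ v < n, ∀ u < n, pos u < pos v → (Nbr tl hd m v u ↔ dom v = 1)
  first : ∀ v < n, pos v = 0 → dom v = 1
  val_iff : ∀ j, val j = 1 ↔ j < n ∧ dom (ord j) = 1 ∧ ∀ u < n, u = ord j ∨
    Arc tl hd m u (ord j) ∨ ∃ w < n, dom w ≠ 1 ∧ j < pos w ∧ (w = u ∨ Arc tl hd m u w)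

/-- Distinct arcs into `v` have distinct tails, and none of them is `v`. So the left side is the
size of `v` together with the counted in-neighbours, a subset of the set on the right; the sizes
agree exactly if the sets do. -/
theorem count_iff {n m : ℕ} {tl hd pos f : ℕ → ℕ} (h : ArcData n m tl hd)
    (hpos : ∀ u < n, ∀ v < n, pos u = pos v → u = v) {v : ℕ} (hv : v < n) (hf : f v ≤ pos v) :
    ((Finset.range m).filter fun e => pos (hd e) = pos v ∧ f (tl e) ≤ pos v).card + 1 =
      ((Finset.range n).filter fun u => f u ≤ pos v).card ↔
    ∀ u < n, u = v ∨ Arc tl hd m u v ∨ pos v < f u := by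
  classical
  set X := (Finset.range m).filter fun e => pos (hd e) = pos v ∧ f (tl e) ≤ pos v with hX
  set Y := (Finset.range n).filter fun u => f u ≤ pos v with hY
  have hhd : ∀ e ∈ X, e < m ∧ hd e = v ∧ f (tl e) ≤ pos v := fun e he => by
    obtain ⟨h1, h2, h3⟩ := Finset.mem_filter.1 he
    have h1 := Finset.mem_range.1 h1
    exact ⟨h1, hpos _ (h.hd_lt e h1) _ hv h2, h3⟩
  have hinj : Set.InjOn tl X := fun e he e' he' heq => by
    obtain ⟨h1, h2, -⟩ := hhd e he
    obtain ⟨h1', h2', -⟩ := hhd e' he'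
    exact h.inj e h1 e' h1' heq (h2.trans h2'.symm)
  have hnot : v ∉ X.image tl := by
    rw [Finset.mem_image]
    rintro ⟨e, he, heq⟩
    obtain ⟨h1, h2, -⟩ := hhd e he
    exact h.ne e h1 (heq.trans h2.symm)
  have hsub : insert v (X.image tl) ⊆ Y := by
    intro u hu
    rcases Finset.mem_insert.1 hu with rfl | hu
    · exact Finset.mem_filter.2 ⟨Finset.mem_range.2 hv, hf⟩
    · obtain ⟨e, he, rfl⟩ := Finset.mem_image.1 hu
      obtain ⟨h1, -, h3⟩ := hhd e he
      exact Finset.mem_filter.2 ⟨Finset.mem_range.2 (h.tl_lt e h1), h3⟩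
  rw [← Finset.card_image_of_injOn hinj, ← Finset.card_insert_of_notMem hnot]
  constructor
  · intro hc u hu
    have heq := Finset.eq_of_subset_of_card_le hsub hc.ge
    by_cases hfu : f u ≤ pos v
    · have : u ∈ insert v (X.image tl) := by
        rw [heq]
        exact Finset.mem_filter.2 ⟨Finset.mem_range.2 hu, hfu⟩
      rcases Finset.mem_insert.1 this with hu | hu
      · exact .inl hu
      · obtain ⟨e, he, rfl⟩ := Finset.mem_image.1 hu
        obtain ⟨h1, h2, -⟩ := hhd e he
        exact .inr (.inl ⟨e, h1, rfl, h2⟩)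
    · exact .inr (.inr (by omega))
  · intro hu
    congr 1
    refine hsub.antisymm fun u huY => ?_
    obtain ⟨hun, hfu⟩ := Finset.mem_filter.1 huY
    rcases hu u (Finset.mem_range.1 hun) with rfl | ⟨e, h1, rfl, rfl⟩ | h
    · exact Finset.mem_insert_self _ _
    · refine Finset.mem_insert_of_mem (Finset.mem_image.2 ⟨e, ?_, rfl⟩)
      exact Finset.mem_filter.2 ⟨Finset.mem_range.2 h1, rfl, hfu⟩
    · omega

/-- The preparatory phase. -/
def prepare : Program :=
  .instr (.const 2 1) ;; rowLoop ;; degLoop ;; bucketLoop ;; peelLoop ;; reachLoop ;;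
    countLoop ;; absorbLoop ;; validLoop

theorem prepare_run {W n m : ℕ} {tl hd : ℕ → ℕ} {s : State} (hd' : ArcData n m tl hd)
    (hex : HasExtremal n (Nbr tl hd m)) (hW : n * n + n + m + 1 < W)
    (h0 : s.var 0 = n) (h1 : s.var 1 = m) (hvar : ∀ x, 2 ≤ x → s.var x = 0)
    (ha0 : ∀ e < m, s.arr 0 e = tl e) (ha1 : ∀ e < m, s.arr 1 e = hd e)
    (harr : ∀ A, 2 ≤ A → ∀ i, s.arr A i = 0) :
    Run W prepare s (51 * n + 37 * m + 20) fun s' => Setup n m tl hd s' ∧ s'.out = s.out ∧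
      Prepared n m tl hd (s'.arr 7) (s'.arr 8) (s'.arr 9) (s'.arr 13) := by
  classical
  refine Run.mono (Q := fun s' => Setup n m tl hd s' ∧ s'.out = s.out ∧
      Prepared n m tl hd (s'.arr 7) (s'.arr 8) (s'.arr 9) (s'.arr 13))
    (t := 1 + ((n * 4 + 2) + ((m * 17 + 2) + ((n * 9 + 2) + ((1 + (1 + (n * 19 + 2))) +
      ((m * 10 + 2) + ((n * 6 + 2) + ((m * 10 + 2) + (1 + (n * 11 + 2)))))))))) ?_ (by omega)
    fun s' h => h
  refine Run.seq (Run.of_wp ⟨by omega, ?_⟩)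
  set s₀ := s.setVar 2 1 with hs₀
  have hs : Setup n m tl hd s₀ :=
    ⟨h0, h1, by simp [hs₀], hvar 30 (by omega), ha0, ha1⟩
  have harr₀ : ∀ A, 2 ≤ A → ∀ i, s₀.arr A i = 0 := harr
  have hv5 : s₀.var 5 = 0 := by simp [hs₀, hvar]
  have hout : s₀.out = s.out := rfl
  clear_value s₀
  refine (rowLoop_run hs (by omega) hv5).andThen fun s₁ f₁ r₁ => ?_
  have hs₁ := hs.frame f₁ (by decide)
  refine (degLoop_run hs₁ hd' (by omega) r₁ (by rw [f₁.arr 3 (by decide)]; exact harr₀ 3 (by omega))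
    (by rw [f₁.arr 4 (by decide)]; exact harr₀ 4 (by omega))).andThen fun s₂ f₂ r₂ => ?_
  have hs₂ := hs₁.frame f₂ (by decide)
  have row₂ : ∀ u < n, s₂.arr 2 u = u * n := by rw [f₂.arr 2 (by decide)]; exact r₁
  refine (bucketLoop_run hs₂ (by omega) row₂ _ (fun u hu => hd'.nbrCount_lt hu) r₂
    (by rw [f₂.arr 6 (by decide), f₁.arr 6 (by decide)]; exact harr₀ 6 (by omega))).andThen
    fun s₃ f₃ r₃ => ?_
  have hs₃ := hs₂.frame f₃ (by decide)
  have row₃ : ∀ u < n, s₃.arr 2 u = u * n := by rw [f₃.arr 2 (by decide)]; exact row₂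
  refine (peelLoop_run hs₃ (by omega) row₃ (Nbr tl hd m) (fun u v => nbr_comm.1) hd'.not_nbr_self hex _
    (fun v hv => rfl) r₃ (by
      rw [f₃.arr 10 (by decide), f₂.arr 10 (by decide), f₁.arr 10 (by decide)]
      exact harr₀ 10 (by omega))).andThen fun s₄ f₄ r₄ => ?_
  have hs₄ := hs₃.frame f₄ (by decide)
  refine (reachLoop_run hs₄ (by omega) (fun v hv => r₄.f_notMem v hv (by simp)) hd'.hd_lt).andThen
    fun s₅ f₅ r₅ => ?_
  have hs₅ := hs₄.frame f₅ (by decide)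
  refine (countLoop_run hs₅ (by omega) (by
      rw [f₅.arr 11 (by decide), f₄.arr 11 (by decide), f₃.arr 11 (by decide),
        f₂.arr 11 (by decide), f₁.arr 11 (by decide)]
      exact harr₀ 11 (by omega))).andThen fun s₆ f₆ r₆ => ?_
  have hs₆ := hs₅.frame f₆ (by decide)
  refine (absorbLoop_run hs₆ (by omega) (by
      rw [f₆.arr 12 (by decide), f₅.arr 12 (by decide), f₄.arr 12 (by decide),
        f₃.arr 12 (by decide), f₂.arr 12 (by decide), f₁.arr 12 (by decide)]
      exact harr₀ 12 (by omega))).andThen fun s₇ f₇ r₇ => ?_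
  have hs₇ := hs₆.frame f₇ (by decide)
  refine (validLoop_run hs₇ hW (fun i => by rw [r₇]; exact card_filter_range_le _ _) (by
      rw [f₇.arr 13 (by decide), f₆.arr 13 (by decide), f₅.arr 13 (by decide),
        f₄.arr 13 (by decide), f₃.arr 13 (by decide), f₂.arr 13 (by decide),
        f₁.arr 13 (by decide)]
      exact harr₀ 13 (by omega)) (by
      rw [f₇.arr 11 (by decide), f₇.arr 10 (by decide), f₆.arr 10 (by decide)]
      exact r₆)).frame.mono le_rfl fun s₈ h => ?_
  obtain ⟨f₈, r₈⟩ := h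
  refine ⟨hs₇.frame f₈ (by decide), ?_, ?_⟩
  · rw [f₈.out (by decide), f₇.out (by decide), f₆.out (by decide), f₅.out (by decide),
      f₄.out (by decide), f₃.out (by decide), f₂.out (by decide), f₁.out (by decide), hout]
  have a7 : s₇.arr 7 = s₄.arr 7 := by
    rw [f₇.arr 7 (by decide), f₆.arr 7 (by decide), f₅.arr 7 (by decide)]
  have a9 : s₇.arr 9 = s₄.arr 9 := by
    rw [f₇.arr 9 (by decide), f₆.arr 9 (by decide), f₅.arr 9 (by decide)]
  have a8 : s₆.arr 8 = s₄.arr 8 := by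
    rw [f₆.arr 8 (by decide), f₅.arr 8 (by decide)]
  have a10 : s₆.arr 10 = s₅.arr 10 := f₆.arr 10 (by decide)
  rw [f₇.arr 10 (by decide), a10] at r₈
  rw [f₈.arr 7 (by decide), f₈.arr 8 (by decide), f₇.arr 8 (by decide), f₈.arr 9 (by decide), a7,
    a8, a9]
  have hpos : ∀ v < n, s₄.arr 8 v < n := fun v hv => (r₄.pos_lt v hv (by simp)).2
  have hord : ∀ v < n, s₄.arr 7 (s₄.arr 8 v) = v := fun v hv => r₄.ord_pos v hv (by simp)
  have hinj : ∀ u < n, ∀ v < n, s₄.arr 8 u = s₄.arr 8 v → u = v := fun u hu v hv h => by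
    rw [← hord u hu, h, hord v hv]
  have hadj : ∀ v < n, ∀ u < n, s₄.arr 8 u < s₄.arr 8 v →
      (Nbr tl hd m v u ↔ s₄.arr 9 v = 1) := fun v hv u hu h =>
    r₄.adj_iff v hv (by simp) u hu (by rintro rfl; exact lt_irrefl _ h) (.inr h)
  have hpo : ∀ p < n, s₄.arr 7 p < n ∧ s₄.arr 8 (s₄.arr 7 p) = p := fun p hp => by
    obtain ⟨h1, -, h2⟩ := r₄.pos_ord p hp (by omega)
    exact ⟨h1, h2⟩
  refine ⟨hpos, hord, fun p hp => (hpo p hp).1, fun p hp => (hpo p hp).2, hadj,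
    fun v hv => r₄.first v hv (by simp), fun j => ?_⟩
  rw [r₈, r₇, a7, a8, a9, a10]
  refine and_congr_right fun hj => and_congr_right fun hdom => ?_
  obtain ⟨hv, hpv⟩ := hpo j hj
  set v := s₄.arr 7 j
  -- A later vertex that is not dominating is not adjacent to `v`, so `v` is itself among the
  -- counted vertices, as `count_iff` requires.
  have hfv : s₅.arr 10 v ≤ s₄.arr 8 v := by
    by_contra! hlt
    obtain ⟨w, hw, h1, h2, rfl | h3⟩ := (r₅ v hv _).1 hlt
    · exact h1 hdom
    · exact h1 ((hadj w hw v hv h2).1 (.inr h3))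
  have := count_iff hd' hinj hv hfv
  rw [hpv] at this
  rw [this]
  refine forall₂_congr fun u hu => ?_
  rw [r₅ u hu]

end RAM

/-! ### Output of the kernels. -/

namespace RAM

/-- The vertices after position `j` that are not dominating. -/
def laterIsolated (n : ℕ) (ord dom : ℕ → ℕ) (j : ℕ) : List ℕ :=
  ((List.range n).filter fun i => decide (j < i ∧ dom (ord i) ≠ 1)).map ord

theorem laterIsolated_succ (k : ℕ) (ord dom : ℕ → ℕ) (j : ℕ) :
    laterIsolated (k + 1) ord dom j = laterIsolated k ord dom j ++
      if j < k ∧ dom (ord k) ≠ 1 then [ord k] else [] := by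
  unfold laterIsolated
  rw [List.range_succ, List.filter_append, List.map_append]
  congr 1
  by_cases h : j < k ∧ dom (ord k) ≠ 1 <;> simp [h]

/-- Outputs the vertices after the position in variable `x` that are not dominating. -/
def emitLoop (x : ℕ) : Program :=
  forLoop 12 0 (.instr (.load 4 7 12) ;; .instr (.load 6 9 4) ;;
    .ite (.lt x 12) (.ite (.eq 6 2) .skip (.instr (.output 4))) .skip)

theorem emitLoop_run {W n m : ℕ} {tl hd : ℕ → ℕ} {s : State} (hs : Setup n m tl hd s)
    (hW : n < W) {x : ℕ} (hx : x ∉ 12 :: (emitLoop x).vars) :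
    Run W (emitLoop x) s (n * 7 + 2) fun s' =>
      s'.out = s.out ++ laterIsolated n (s.arr 7) (s.arr 9) (s.var x) := by
  have hx' : x ≠ 4 ∧ x ≠ 6 ∧ x ≠ 12 := by
    refine ⟨?_, ?_, ?_⟩ <;> rintro rfl <;> exact hx (by decide)
  obtain ⟨hx4, hx6, hx12⟩ := hx'
  refine (Run.forLoop_wp (fun k s' => s'.out = s.out ++
      laterIsolated k (s.arr 7) (s.arr 9) (s.var x)) (by decide)
      (by change 12 ∉ [4, 6] ∧ 0 ∉ [4, 6] ∧ 2 ∉ [4, 6]; decide) hs.var0 hs.var2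
      (by omega) (by simp [laterIsolated]) ?_).mono le_rfl fun s' h => h
  intro k hk s' hf hi hI
  have hs' := hs.frame hf (by
    change (0 ∉ [12, 4, 6, 12] ∧ 1 ∉ [12, 4, 6, 12] ∧ 2 ∉ [12, 4, 6, 12] ∧ 30 ∉ [12, 4, 6, 12]) ∧
      0 ∉ [] ∧ 1 ∉ []
    decide)
  have h7 : s'.arr 7 = s.arr 7 := hf.arr 7 (by change 7 ∉ []; decide)
  have h9 : s'.arr 9 = s.arr 9 := hf.arr 9 (by change 9 ∉ []; decide)
  have hvx : s'.var x = s.var x := hf.var x (fun h => hx (List.mem_cons_of_mem _ h))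
  simp [Program.wp, Instr.wp, hi, hs'.var2, h7, h9, hI, hx4, hx6, hvx, laterIsolated_succ]
  by_cases h1 : s.var x < k <;> by_cases h2 : s.arr 9 (s.arr 7 k) = 1 <;>
    simp_all

/-- Counts the marked positions in variable `10` and stores the last one in variable `11`. -/
def tallyLoop : Program :=
  forLoop 3 0 (.instr (.load 4 13 3) ;;
    .ite (.eq 4 2) (.instr (.add 10 10 2) ;; .instr (.move 11 3)) .skip)

theorem tallyLoop_run {W n m : ℕ} {tl hd : ℕ → ℕ} {s : State} (hs : Setup n m tl hd s)
    (hW : n < W) (h10 : s.var 10 = 0) :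
    Run W tallyLoop s (n * 6 + 2) fun s' =>
      s'.var 10 = ((Finset.range n).filter fun j => s.arr 13 j = 1).card ∧
      (s'.var 10 ≠ 0 → s.arr 13 (s'.var 11) = 1) := by
  refine (Run.forLoop_wp (fun k s' => s'.var 10 =
      ((Finset.range k).filter fun j => s.arr 13 j = 1).card ∧
      (s'.var 10 ≠ 0 → s.arr 13 (s'.var 11) = 1)) (by decide) (by decide) hs.var0 hs.var2
      (by omega) (by simp [h10]) ?_).mono le_rfl fun s' h => h
  rintro k hk s' hf hi ⟨hI, hJ⟩
  have hs' := hs.frame hf (by decide)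
  have h13 : s'.arr 13 = s.arr 13 := hf.arr 13 (by decide)
  have := card_filter_range_le (fun j => s.arr 13 j = 1) k
  rw [hI] at hJ
  simp [Program.wp, Instr.wp, hi, hs'.var2, h13, hI, card_filter_range_succ]
  refine ⟨fun h => ⟨by omega, h⟩, fun h => ⟨h, ?_⟩⟩
  intro x hx hx'
  exact hJ (Finset.card_ne_zero.2 ⟨x, Finset.mem_filter.2 ⟨Finset.mem_range.2 hx, hx'⟩⟩)

/-- The program that outputs the number of kernels and one kernel. -/
def countKernels : Program :=
  prepare ;; .instr (.const 10 0) ;; tallyLoop ;; .instr (.output 10) ;;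
    .ite (.eq 10 30) .skip (.instr (.load 4 7 11) ;; .instr (.output 4) ;; emitLoop 11)

theorem countKernels_run {W n m : ℕ} {tl hd : ℕ → ℕ} {s : State} (hd' : ArcData n m tl hd)
    (hex : HasExtremal n (Nbr tl hd m)) (hW : n * n + n + m + 1 < W)
    (h0 : s.var 0 = n) (h1 : s.var 1 = m) (hvar : ∀ x, 2 ≤ x → s.var x = 0)
    (ha0 : ∀ e < m, s.arr 0 e = tl e) (ha1 : ∀ e < m, s.arr 1 e = hd e)
    (harr : ∀ A, 2 ≤ A → ∀ i, s.arr A i = 0) (hout : s.out = []) :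
    Run W countKernels s (64 * n + 37 * m + 31) fun s' =>
      ∃ ord pos dom val, Prepared n m tl hd ord pos dom val ∧
      (((Finset.range n).filter fun j => val j = 1) = ∅ ∧ s'.out = [0] ∨
      ∃ j, val j = 1 ∧ s'.out = ((Finset.range n).filter fun j => val j = 1).card ::
        ord j :: laterIsolated n ord dom j) := by
  refine Run.mono (t := (51 * n + 37 * m + 20) + (1 + ((n * 6 + 2) + (1 + (1 +
    (1 + (1 + (n * 7 + 2)))))))) ?_ (by omega) fun s' h => h
  refine (prepare_run hd' hex hW h0 h1 hvar ha0 ha1 harr).andThen fun s₁ f₁ ⟨hs₁, ho₁, hP⟩ => ?_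
  rw [hout] at ho₁
  refine Run.andThen (R := fun s₂ => s₂.var 10 = 0) (Run.of_wp ⟨by omega, by simp⟩)
    fun s₂ f₂ h10 => ?_
  have hs₂ := hs₁.frame f₂ (by decide)
  refine (tallyLoop_run hs₂ (by omega) h10).andThen fun s₃ f₃ ⟨r₃, r₃'⟩ => ?_
  have hs₃ := hs₂.frame f₃ (by decide)
  rw [f₂.arr 13 (by decide)] at r₃ r₃'
  have a7 : s₃.arr 7 = s₁.arr 7 := by rw [f₃.arr 7 (by decide), f₂.arr 7 (by decide)]
  have a9 : s₃.arr 9 = s₁.arr 9 := by rw [f₃.arr 9 (by decide), f₂.arr 9 (by decide)]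
  have o₃ : s₃.out = [] := by rw [f₃.out (by decide), f₂.out (by decide), ho₁]
  refine Run.seq (Run.of_wp ?_)
  change Run _ _ _ _ _
  refine Run.ite (fun hb => ?_) fun hb => ?_
  · refine Run.mono (Run.of_wp (p := .skip) (Q := fun s' => s' = s₃.emit (s₃.var 10)) rfl)
      (by simp only [Program.cost]; omega) ?_
    rintro s' rfl
    have hz : s₃.var 10 = 0 := by simpa [hs₃.var30] using hb
    refine ⟨_, _, _, _, hP, .inl ⟨?_, by simp [o₃, hz]⟩⟩
    rw [← Finset.card_eq_zero, ← r₃, hz]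
  · have hz : s₃.var 10 ≠ 0 := by simpa [hs₃.var30] using hb
    refine Run.seq (Run.of_wp ?_)
    change Run _ _ _ _ _
    refine Run.seq (Run.of_wp ?_)
    change Run _ _ _ _ _
    refine (emitLoop_run (n := n) (m := m) (tl := tl) (hd := hd) ?_ (by omega) (by decide)).mono
      le_rfl fun s' h => ?_
    · exact ⟨hs₃.var0, hs₃.var1, hs₃.var2, hs₃.var30, hs₃.arr0, hs₃.arr1⟩
    · refine ⟨_, _, _, _, hP, .inr ⟨_, r₃' hz, ?_⟩⟩
      rw [h]
      simp [o₃, a7, a9, r₃]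

/-- Computes in variable `10` the number of vertices of the kernel that belongs to the position in
variable `3`. -/
def sizeLoop : Program :=
  forLoop 12 0 (.instr (.load 4 7 12) ;; .instr (.load 6 9 4) ;;
    .ite (.lt 3 12) (.ite (.eq 6 2) .skip (.instr (.add 10 10 2))) .skip)

theorem laterIsolated_length_le (k : ℕ) (ord dom : ℕ → ℕ) (j : ℕ) :
    (laterIsolated k ord dom j).length ≤ k := by
  unfold laterIsolated
  rw [List.length_map]
  exact (List.length_filter_le _ _).trans (by simp)

/-- The length precedes the list on the tape, so the positions are scanned twice per kernel. The
initial value 1 stands for the dominating vertex itself. -/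
theorem sizeLoop_run {W n m : ℕ} {tl hd : ℕ → ℕ} {s : State} (hs : Setup n m tl hd s)
    (hW : n + 1 < W) (h10 : s.var 10 = 1) :
    Run W sizeLoop s (n * 7 + 2) fun s' =>
      s'.var 10 = (laterIsolated n (s.arr 7) (s.arr 9) (s.var 3)).length + 1 := by
  refine (Run.forLoop_wp (fun k s' => s'.var 10 =
      (laterIsolated k (s.arr 7) (s.arr 9) (s.var 3)).length + 1) (by decide) (by decide)
      hs.var0 hs.var2 (by omega) (by simp [laterIsolated, h10]) ?_).mono le_rfl fun s' h => h
  intro k hk s' hf hi hI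
  have hs' := hs.frame hf (by decide)
  have h7 : s'.arr 7 = s.arr 7 := hf.arr 7 (by decide)
  have h9 : s'.arr 9 = s.arr 9 := hf.arr 9 (by decide)
  have hvx : s'.var 3 = s.var 3 := hf.var 3 (by decide)
  have := laterIsolated_length_le k (s.arr 7) (s.arr 9) (s.var 3)
  simp [Program.wp, Instr.wp, hi, hs'.var2, h7, h9, hI, hvx, laterIsolated_succ]
  refine ⟨fun h1 => ⟨fun h2 => by simp [h2], fun h2 => ⟨by omega, by simp [h1, h2]⟩⟩, fun h1 => ?_⟩
  simp [h1]

/-- Outputs all kernels. -/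
def emitAllLoop : Program :=
  forLoop 3 0 (.instr (.load 4 13 3) ;;
    .ite (.eq 4 2) (.instr (.const 10 1) ;; sizeLoop ;; .instr (.output 10) ;;
      .instr (.load 4 7 3) ;; .instr (.output 4) ;; emitLoop 3) .skip)

/-- The list of the vertices of the kernels that belong to the first `k` positions. -/
def kernelLists (n : ℕ) (ord dom val : ℕ → ℕ) (k : ℕ) : List (List ℕ) :=
  ((List.range k).filter fun j => decide (val j = 1)).map
    fun j => ord j :: laterIsolated n ord dom j

theorem emitAllLoop_run {W n m : ℕ} {tl hd : ℕ → ℕ} {s : State} (hs : Setup n m tl hd s)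
    (hW : n + 1 < W) :
    Run W emitAllLoop s
      (((Finset.range n).filter fun j => s.arr 13 j = 1).card * (n * 14 + 7) + n * 5 + 2)
      fun s' => s'.out = s.out ++ (kernelLists n (s.arr 7) (s.arr 9) (s.arr 13) n).flatMap
        fun l => l.length :: l := by
  -- An unmarked position costs 3 for load, test and `skip`; the two scans and the outputs are
  -- charged to marked positions only.
  refine Run.mono (Run.forLoop (t := fun j => 3 + if s.arr 13 j = 1 then n * 14 + 7 else 0)
    (fun k s' => s'.out = s.out ++ (kernelLists n (s.arr 7) (s.arr 9) (s.arr 13) k).flatMap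
        fun l => l.length :: l) (by decide) (by decide) hs.var0 hs.var2 (by omega)
        (by simp [kernelLists]) ?_) ?_ fun s' h => h
  · intro k hk s' hf hi hI
    have hs' := hs.frame hf (by decide)
    have h7 : s'.arr 7 = s.arr 7 := hf.arr 7 (by decide)
    have h9 : s'.arr 9 = s.arr 9 := hf.arr 9 (by decide)
    have h13 : s'.arr 13 = s.arr 13 := hf.arr 13 (by decide)
    have hsucc : kernelLists n (s.arr 7) (s.arr 9) (s.arr 13) (k + 1) =
        kernelLists n (s.arr 7) (s.arr 9) (s.arr 13) k ++
        if s.arr 13 k = 1 then [s.arr 7 k :: laterIsolated n (s.arr 7) (s.arr 9) k] else [] := by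
      unfold kernelLists
      rw [List.range_succ, List.filter_append, List.map_append]
      congr 1
      by_cases h : s.arr 13 k = 1 <;> simp [h]
    rw [hsucc]
    by_cases hval : s.arr 13 k = 1
    · simp only [hval, if_true]
      refine Run.mono (t := 1 + (1 + (1 + ((n * 7 + 2) + (1 + (1 + (1 + (n * 7 + 2))))))))
        (Run.seq (Run.of_wp ?_)) (by omega) fun s' h => h
      change Run _ _ _ _ _
      refine Run.ite (fun _ => ?_) fun hb => absurd ?_ hb
      · refine Run.andThen (R := fun s₂ => s₂.var 10 = 1 ∧ s₂.var 3 = k) (Run.of_wp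
          ⟨by omega, by simp [hi]⟩) fun s₂ f₂ ⟨h10, hk₂⟩ => ?_
        have hs₁ : Setup n m tl hd (s'.setVar 4 (s'.arr 13 (s'.var 3))) :=
          ⟨hs'.var0, hs'.var1, hs'.var2, hs'.var30, hs'.arr0, hs'.arr1⟩
        have hs₂ := hs₁.frame f₂ (by decide)
        refine (sizeLoop_run hs₂ hW h10).andThen fun s₃ f₃ r₃ => ?_
        have hs₃ := hs₂.frame f₃ (by decide)
        have b7 : s₂.arr 7 = s.arr 7 := (f₂.arr 7 (by decide)).trans h7
        have b9 : s₂.arr 9 = s.arr 9 := (f₂.arr 9 (by decide)).trans h9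
        have a7 : s₃.arr 7 = s.arr 7 := (f₃.arr 7 (by decide)).trans b7
        have a9 : s₃.arr 9 = s.arr 9 := (f₃.arr 9 (by decide)).trans b9
        have o₃ : s₃.out = s'.out := (f₃.out (by decide)).trans (f₂.out (by decide))
        have hk₃ : s₃.var 3 = k := (f₃.var 3 (by decide)).trans hk₂
        refine Run.seq (Run.of_wp ?_)
        change Run _ _ _ _ _
        refine Run.seq (Run.of_wp ?_)
        change Run _ _ _ _ _
        refine Run.seq (Run.of_wp ?_)
        change Run _ _ _ _ _
        refine (emitLoop_run (n := n) (m := m) (tl := tl) (hd := hd) ?_ (by omega)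
          (by decide)).mono le_rfl fun s₄ h => ?_
        · exact ⟨hs₃.var0, hs₃.var1, hs₃.var2, hs₃.var30, hs₃.arr0, hs₃.arr1⟩
        · rw [State.out_setVar, h]
          simp [o₃, a7, a9, r₃, hI, hk₃, b7, b9, hk₂]
      · simp [hi, h13, hval, hs'.var2]
    · simp only [hval, if_false]
      refine Run.mono (Run.of_wp (p := .instr (.load 4 13 3)) (Q := fun s' =>
        s'.out = s.out ++ (kernelLists n (s.arr 7) (s.arr 9) (s.arr 13) k).flatMap
          (fun l => l.length :: l) ∧ s'.var 4 ≠ 1 ∧ s'.var 2 = 1) ?_)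
        le_rfl (fun s₂ h => ?_) |>.seq (t' := 2) |>.mono (by simp [Program.cost]) fun s' h => h
      · simp [Program.wp, Instr.wp, hi, h13, hval, hs'.var2, hI]
      · obtain ⟨h1, h2, h3⟩ := h
        change Run W _ s₂ (1 + 1) _
        refine Run.ite (fun hb => absurd (hb.trans h3) h2) fun _ => ?_
        exact Run.of_wp (p := .skip) (by simpa [Program.wp] using h1)
  · simp only [Finset.sum_add_distrib, Finset.sum_const, Finset.card_range, smul_eq_mul,
      ← Finset.sum_filter]
    exact le_of_eq (by ring)

/-- The program that outputs all kernels. -/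
def enumKernels : Program :=
  prepare ;; emitAllLoop

theorem enumKernels_run {W n m : ℕ} {tl hd : ℕ → ℕ} {s : State} (hd' : ArcData n m tl hd)
    (hex : HasExtremal n (Nbr tl hd m)) (hW : n * n + n + m + 1 < W)
    (h0 : s.var 0 = n) (h1 : s.var 1 = m) (hvar : ∀ x, 2 ≤ x → s.var x = 0)
    (ha0 : ∀ e < m, s.arr 0 e = tl e) (ha1 : ∀ e < m, s.arr 1 e = hd e)
    (harr : ∀ A, 2 ≤ A → ∀ i, s.arr A i = 0) (hout : s.out = []) {b : ℕ}
    (hb : ∀ ord pos dom val, Prepared n m tl hd ord pos dom val →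
      ((Finset.range n).filter fun j => val j = 1).card ≤ b) :
    Run W enumKernels s (b * (n * 14 + 7) + 56 * n + 37 * m + 22) fun s' =>
      ∃ ord pos dom val, Prepared n m tl hd ord pos dom val ∧
      s'.out = (kernelLists n ord dom val n).flatMap fun l => l.length :: l := by
  refine Run.mono (t := (51 * n + 37 * m + 20) + (b * (n * 14 + 7) + n * 5 + 2)) ?_ (by omega)
    fun s' h => h
  refine (prepare_run hd' hex hW h0 h1 hvar ha0 ha1 harr).andThen fun s₁ f₁ ⟨hs₁, ho₁, hP⟩ => ?_
  refine (emitAllLoop_run hs₁ (by omega)).mono ?_ fun s' h => ⟨_, _, _, _, hP, ?_⟩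
  · have := Nat.mul_le_mul_right (n * 14 + 7) (hb _ _ _ _ hP)
    omega
  · rw [h, ho₁, hout, List.nil_append]

end RAM

/-! ### The kernels of an oriented threshold graph -/

/-- Among the members of `R`, the one added last in the construction is adjacent to all others or to
none. -/
theorem SimpleGraph.IsThresholdOn.exists_extremal {V : Type*} {G : SimpleGraph V} {S : Set V}
    (h : G.IsThresholdOn S) (R : Set V) (hR : R ⊆ S) (hne : R.Nonempty) :
    ∃ v ∈ R, (∀ u ∈ R, u ≠ v → G.Adj v u) ∨ (∀ u ∈ R, ¬ G.Adj v u) := by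
  induction h with
  | single v =>
    obtain ⟨w, hw⟩ := hne
    refine ⟨w, hw, .inl fun u hu hne => absurd ?_ hne⟩
    rw [Set.mem_singleton_iff.1 (hR hu), Set.mem_singleton_iff.1 (hR hw)]
  | union v S hv h _ ih =>
    by_cases hvR : v ∈ R
    · refine ⟨v, hvR, .inr fun u hu => ?_⟩
      rcases hR hu with rfl | hu
      · exact G.irrefl
      · exact h u hu
    · refine ih fun u hu => (hR hu).resolve_left ?_
      rintro rfl
      exact hvR hu
  | join v S hv h _ ih =>
    by_cases hvR : v ∈ R
    · exact ⟨v, hvR, .inl fun u hu hne => h u ((hR hu).resolve_left hne)⟩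
    · refine ih fun u hu => (hR hu).resolve_left ?_
      rintro rfl
      exact hvR hu

theorem SimpleGraph.IsThresholdOn.nonempty {V : Type*} {G : SimpleGraph V} {S : Set V}
    (h : G.IsThresholdOn S) : S.Nonempty := by
  cases h
  · exact Set.singleton_nonempty _
  · exact Set.insert_nonempty _ _
  · exact Set.insert_nonempty _ _

namespace Digraph

/-- The positions of the vertices in a construction sequence of the underlying threshold graph;
`dom v` means that `v` is adjacent to all earlier vertices. -/
structure IsThresholdOrder {V : Type*} (D : Digraph V) (pos : V → ℕ) (dom : V → Prop) : Prop where
  loopless : D.IsLoopless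
  pos_injective : Function.Injective pos
  adj_iff : ∀ u v, pos u < pos v → ((D.Adj v u ∨ D.Adj u v) ↔ dom v)
  exists_first : ∃ v, pos v = 0
  first : ∀ v, pos v = 0 → dom v

open Classical in
/-- The vertex `c` together with the later vertices that are not dominating. -/
noncomputable def candidate {V : Type*} [Fintype V] (pos : V → ℕ) (dom : V → Prop) (c : V) :
    Finset V :=
  Finset.univ.filter fun w => w = c ∨ (¬ dom w ∧ pos c < pos w)

theorem mem_candidate {V : Type*} [Fintype V] {pos : V → ℕ} {dom : V → Prop} {c w : V} :
    w ∈ candidate pos dom c ↔ w = c ∨ (¬ dom w ∧ pos c < pos w) := by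
  simp [candidate]

/-- `c` is the only dominating member of its candidate if it is dominating at all. -/
theorem candidate_injOn {V : Type*} [Fintype V] {pos : V → ℕ} {dom : V → Prop} {c c' : V}
    (hc : dom c) (h : candidate pos dom c = candidate pos dom c') : c = c' := by
  have : c ∈ candidate pos dom c' := h ▸ mem_candidate.2 (.inl rfl)
  rcases mem_candidate.1 this with h | h
  · exact h
  · exact absurd hc h.1

theorem IsThresholdOrder.not_adj {V : Type*} {D : Digraph V} {pos : V → ℕ} {dom : V → Prop}
    (h : D.IsThresholdOrder pos dom) {u v : V} (huv : pos u ≤ pos v) (hv : u ≠ v → ¬ dom v) :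
    ¬ D.Adj u v ∧ ¬ D.Adj v u := by
  by_cases hne : u = v
  · subst hne
    exact ⟨h.loopless u, h.loopless u⟩
  · have := h.adj_iff u v (huv.lt_of_ne fun he => hne (h.pos_injective he))
    have := hv hne
    tauto

/-- A kernel has exactly one dominating vertex, and this vertex determines it; conversely candidates
are always independent, so absorption is the only condition left. -/
theorem IsThresholdOrder.isKernel_iff {V : Type*} [Fintype V] {D : Digraph V} {pos : V → ℕ}
    {dom : V → Prop} (h : D.IsThresholdOrder pos dom) (S : Finset V) :
    D.IsKernel S ↔ ∃ c, dom c ∧ (∀ u, u = c ∨ D.Adj u c ∨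
      ∃ w, ¬ dom w ∧ pos c < pos w ∧ (w = u ∨ D.Adj u w)) ∧ candidate pos dom c = S := by
  constructor
  · rintro ⟨hind, habs⟩
    -- If the first vertex is outside of `S`, the out-neighbour that absorbs it comes later and is
    -- adjacent to it, hence dominating.
    have hcore : ∃ c ∈ S, dom c := by
      obtain ⟨v, hv⟩ := h.exists_first
      by_cases hvS : v ∈ S
      · exact ⟨v, hvS, h.first v hv⟩
      · obtain ⟨w, hw, hvw⟩ := habs v hvS
        refine ⟨w, hw, ?_⟩
        by_contra hdom
        exact (h.not_adj (by omega) fun _ => hdom).1 hvw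
    obtain ⟨c, hcS, hc⟩ := hcore
    have hS : candidate pos dom c = S := by
      ext w
      rw [mem_candidate]
      constructor
      · rintro (rfl | ⟨hw, hlt⟩)
        · exact hcS
        -- An absorbing out-neighbour `x` of `w` would be later than `w` and dominating, hence
        -- adjacent to `c`, against independence.
        · by_contra hwS
          obtain ⟨x, hx, hwx⟩ := habs w hwS
          rcases le_total (pos x) (pos w) with hle | hle
          · exact (h.not_adj hle fun _ => hw).2 hwx
          · by_cases hxd : dom x
            · refine hind c hcS x hx ?_ |>.elim
              have := (h.adj_iff c x (by omega)).2 hxd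
              exact this.elim (fun h => absurd h (hind x hx c hcS)) id
            · exact (h.not_adj hle fun _ => hxd).1 hwx
      · intro hw
        by_cases hwc : w = c
        · exact .inl hwc
        right
        have hne : pos w ≠ pos c := fun he => hwc (h.pos_injective he)
        rcases hne.lt_or_gt with hlt | hlt
        · rcases (h.adj_iff w c hlt).2 hc with h' | h'
          · exact absurd h' (hind c hcS w hw)
          · exact absurd h' (hind w hw c hcS)
        · refine ⟨fun hd => ?_, hlt⟩
          rcases (h.adj_iff c w hlt).2 hd with h' | h'
          · exact absurd h' (hind w hw c hcS)
          · exact absurd h' (hind c hcS w hw)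
    refine ⟨c, hc, fun u => ?_, hS⟩
    by_cases hu : u ∈ S
    · rw [← hS, mem_candidate] at hu
      rcases hu with hu | ⟨h1, h2⟩
      · exact .inl hu
      · exact .inr (.inr ⟨u, h1, h2, .inl rfl⟩)
    · obtain ⟨w, hw, huw⟩ := habs u hu
      rw [← hS, mem_candidate] at hw
      rcases hw with rfl | ⟨h1, h2⟩
      · exact .inr (.inl huw)
      · exact .inr (.inr ⟨w, h1, h2, .inr huw⟩)
  · rintro ⟨c, hc, hu, rfl⟩
    refine ⟨fun u hu v hv => ?_, fun u huS => ?_⟩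
    · rw [mem_candidate] at hu hv
      rcases hu with rfl | ⟨h1, h2⟩ <;> rcases hv with rfl | ⟨h3, h4⟩
      · exact h.loopless _
      · exact (h.not_adj h4.le fun _ => h3).1
      · exact (h.not_adj h2.le fun _ => h1).2
      · rcases le_total (pos u) (pos v) with hle | hle
        · exact (h.not_adj hle fun _ => h3).1
        · exact (h.not_adj hle fun _ => h1).2
    · rw [mem_candidate] at huS
      rcases hu u with h1 | h1 | ⟨w, h1, h2, rfl | h3⟩
      · exact absurd (.inl h1) huS
      · exact ⟨c, mem_candidate.2 (.inl rfl), h1⟩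
      · exact absurd (.inr ⟨h1, h2⟩) huS
      · exact ⟨w, mem_candidate.2 (.inr ⟨h1, h2⟩), h3⟩

theorem IsArcList.size_eq {n : ℕ} {D : Digraph (Fin n)} {L : List (Fin n × Fin n)}
    (h : D.IsArcList L) : D.size = n + L.length := by
  unfold size
  rw [Nat.card_eq_fintype_card, Fintype.card_fin, Nat.subtype_card L.toFinset,
    List.toFinset_card_of_nodup h.1]
  rintro ⟨u, v⟩
  rw [List.mem_toFinset, h.2]

end Digraph

/-! ### Transfer between arc lists and digraphs. -/

namespace RAM

/-- The tail of the arc with index `e`. -/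
def tailOf {n : ℕ} (L : List (Fin n × Fin n)) (e : ℕ) : ℕ :=
  (L.map fun e => (e.1 : ℕ)).getD e 0

/-- The head of the arc with index `e`. -/
def headOf {n : ℕ} (L : List (Fin n × Fin n)) (e : ℕ) : ℕ :=
  (L.map fun e => (e.2 : ℕ)).getD e 0

theorem tailOf_eq {n : ℕ} (L : List (Fin n × Fin n)) {e : ℕ} (he : e < L.length) :
    tailOf L e = (L[e].1 : ℕ) := by
  simp [tailOf, he]

theorem headOf_eq {n : ℕ} (L : List (Fin n × Fin n)) {e : ℕ} (he : e < L.length) :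
    headOf L e = (L[e].2 : ℕ) := by
  simp [headOf, he]

theorem arc_iff {n : ℕ} {T : Digraph (Fin n)} {L : List (Fin n × Fin n)} (hL : T.IsArcList L)
    (u v : Fin n) : Arc (tailOf L) (headOf L) L.length u v ↔ T.Adj u v := by
  rw [← hL.2, List.mem_iff_getElem]
  constructor
  · rintro ⟨e, he, h1, h2⟩
    rw [tailOf_eq L he] at h1
    rw [headOf_eq L he] at h2
    exact ⟨e, he, Prod.ext (Fin.ext h1) (Fin.ext h2)⟩
  · rintro ⟨e, he, h⟩
    exact ⟨e, he, by rw [tailOf_eq L he, h], by rw [headOf_eq L he, h]⟩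

theorem nbr_iff {n : ℕ} {T : Digraph (Fin n)} {L : List (Fin n × Fin n)} (hL : T.IsArcList L)
    (u v : Fin n) : Nbr (tailOf L) (headOf L) L.length u v ↔ T.Adj u v ∨ T.Adj v u := by
  rw [Nbr, arc_iff hL, arc_iff hL]

theorem arcData {n : ℕ} {T : Digraph (Fin n)} {L : List (Fin n × Fin n)} (hT : T.IsLoopless)
    (hL : T.IsArcList L) : ArcData n L.length (tailOf L) (headOf L) where
  tl_lt e he := by rw [tailOf_eq L he]; exact Fin.isLt _
  hd_lt e he := by rw [headOf_eq L he]; exact Fin.isLt _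
  ne e he h := by
    rw [tailOf_eq L he, headOf_eq L he] at h
    have : T.Adj L[e].1 L[e].2 := (hL.2 _ _).1 (List.getElem_mem he)
    rw [Fin.ext h] at this
    exact hT _ this
  inj e he e' he' h1 h2 := by
    rw [tailOf_eq L he, tailOf_eq L he'] at h1
    rw [headOf_eq L he, headOf_eq L he'] at h2
    exact (hL.1.getElem_inj_iff).1 (Prod.ext (Fin.ext h1) (Fin.ext h2))

theorem hasExtremal {n : ℕ} {T : Digraph (Fin n)} {L : List (Fin n × Fin n)}
    (hT : T.IsLoopless) (hG : T.toSimpleGraphInclusive.IsThreshold) (hL : T.IsArcList L) :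
    HasExtremal n (Nbr (tailOf L) (headOf L) L.length) := by
  intro R hR hne
  have hlt : ∀ v ∈ R, v < n := fun v hv => by simpa using hR hv
  have hadj : ∀ u v : Fin n, T.toSimpleGraphInclusive.Adj u v ↔
      Nbr (tailOf L) (headOf L) L.length u v := fun u v => by
    rw [nbr_iff hL, Digraph.toSimpleGraphInclusive, SimpleGraph.fromRel_adj]
    refine and_iff_right_of_imp ?_
    rintro (h | h) rfl <;> exact hT _ h
  obtain ⟨v, hv, h⟩ := hG.exists_extremal {v : Fin n | (v : ℕ) ∈ R} (Set.subset_univ _) (by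
    obtain ⟨v, hv⟩ := hne
    exact ⟨⟨v, hlt v hv⟩, hv⟩)
  refine ⟨v, hv, h.imp (fun h u hu hne => ?_) fun h u hu => ?_⟩
  · exact (hadj v ⟨u, hlt u hu⟩).1 (h ⟨u, hlt u hu⟩ hu fun he => hne (congrArg Fin.val he))
  · exact fun hn => h ⟨u, hlt u hu⟩ hu ((hadj v ⟨u, hlt u hu⟩).2 hn)

section

variable {n : ℕ} {T : Digraph (Fin n)} {L : List (Fin n × Fin n)} {ord pos dom val : ℕ → ℕ}

theorem Prepared.isThresholdOrder (hT : T.IsLoopless) (hL : T.IsArcList L) (hn : 0 < n)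
    (h : Prepared n L.length (tailOf L) (headOf L) ord pos dom val) :
    T.IsThresholdOrder (fun v => pos v) (fun v => dom v = 1) where
  loopless := hT
  pos_injective u v huv := Fin.ext <| by
    have huv : pos u = pos v := huv
    rw [← h.ord_pos u u.2, huv, h.ord_pos v v.2]
  adj_iff u v huv := by rw [← nbr_iff hL]; exact h.adj_iff v v.2 u u.2 huv
  exists_first := ⟨⟨ord 0, h.ord_lt 0 hn⟩, h.pos_ord 0 hn⟩
  first v hv := h.first v v.2 hv

/-- The kernel that belongs to a position. -/
noncomputable def kernelAt (hn : 0 < n) (ord pos dom : ℕ → ℕ) (j : ℕ) : Finset (Fin n) :=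
  Digraph.candidate (fun v : Fin n => pos v) (fun v => dom v = 1)
    -- The vertex `0` is a junk value; it plays no role for positions `j < n`.
    (if h : ord j < n then ⟨ord j, h⟩ else ⟨0, hn⟩)

theorem Prepared.kernelAt_eq (hn : 0 < n)
    (h : Prepared n L.length (tailOf L) (headOf L) ord pos dom val) {j : ℕ} (hj : j < n) :
    kernelAt hn ord pos dom j = Digraph.candidate (fun v : Fin n => pos v) (fun v => dom v = 1)
      ⟨ord j, h.ord_lt j hj⟩ := by
  rw [kernelAt, dif_pos]

theorem Prepared.val_lt (h : Prepared n L.length (tailOf L) (headOf L) ord pos dom val) {j : ℕ}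
    (hj : val j = 1) : j < n :=
  ((h.val_iff j).1 hj).1

theorem Prepared.isKernel_iff (hT : T.IsLoopless) (hL : T.IsArcList L) (hn : 0 < n)
    (h : Prepared n L.length (tailOf L) (headOf L) ord pos dom val) (S : Finset (Fin n)) :
    T.IsKernel S ↔ ∃ j, val j = 1 ∧ kernelAt hn ord pos dom j = S := by
  rw [(h.isThresholdOrder hT hL hn).isKernel_iff]
  constructor
  · rintro ⟨c, hc, hu, rfl⟩
    have hp := h.pos_lt c c.2
    have ho := h.ord_pos c c.2
    refine ⟨pos c, (h.val_iff _).2 ⟨hp, by rwa [ho], fun u hu' => ?_⟩, ?_⟩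
    · rw [ho]
      rcases hu ⟨u, hu'⟩ with h1 | h1 | ⟨w, h1, h2, h3⟩
      · exact .inl (congrArg Fin.val h1)
      · exact .inr (.inl ((arc_iff hL ⟨u, hu'⟩ c).2 h1))
      · exact .inr (.inr ⟨w, w.2, h1, h2, h3.imp (congrArg Fin.val)
          (arc_iff hL ⟨u, hu'⟩ w).2⟩)
    · rw [h.kernelAt_eq hn hp]
      congr 1
      exact Fin.ext ho
  · rintro ⟨j, hj, rfl⟩
    obtain ⟨hjn, hd, hu⟩ := (h.val_iff j).1 hj
    refine ⟨⟨ord j, h.ord_lt j hjn⟩, hd, fun u => ?_, (h.kernelAt_eq hn hjn).symm⟩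
    rcases hu u u.2 with h1 | h1 | ⟨w, hw, h1, h2, h3⟩
    · exact .inl (Fin.ext h1)
    · exact .inr (.inl ((arc_iff hL u ⟨ord j, h.ord_lt j hjn⟩).1 h1))
    · exact .inr (.inr ⟨⟨w, hw⟩, h1, by simpa [h.pos_ord j hjn] using h2,
        h3.imp (fun h => Fin.ext h) (arc_iff hL u ⟨w, hw⟩).1⟩)

theorem Prepared.kernelAt_inj (hn : 0 < n)
    (h : Prepared n L.length (tailOf L) (headOf L) ord pos dom val) {i j : ℕ} (hi : val i = 1)
    (hj : val j = 1) (hij : kernelAt hn ord pos dom i = kernelAt hn ord pos dom j) : i = j := by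
  obtain ⟨hin, hd, -⟩ := (h.val_iff i).1 hi
  have hjn := h.val_lt hj
  rw [h.kernelAt_eq hn hin, h.kernelAt_eq hn hjn] at hij
  have := congrArg Fin.val (Digraph.candidate_injOn (dom := fun v : Fin n => dom v = 1) hd hij)
  rw [← h.pos_ord i hin, ← h.pos_ord j hjn]
  exact congrArg pos this

theorem Prepared.ncard_eq (hT : T.IsLoopless) (hL : T.IsArcList L) (hn : 0 < n)
    (h : Prepared n L.length (tailOf L) (headOf L) ord pos dom val) :
    {S : Finset (Fin n) | T.IsKernel S}.ncard =
      ((Finset.range n).filter fun j => val j = 1).card := by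
  have : {S : Finset (Fin n) | T.IsKernel S} =
      kernelAt hn ord pos dom '' ((Finset.range n).filter fun j => val j = 1 : Finset ℕ) := by
    ext S
    rw [Set.mem_ofPred_eq, h.isKernel_iff hT hL hn, Set.mem_image]
    refine exists_congr fun j => and_congr_left fun _ => ?_
    simp only [Finset.coe_filter, Finset.mem_range, Set.mem_ofPred_eq]
    exact ⟨fun hj => ⟨h.val_lt hj, hj⟩, And.right⟩
  rw [this, Set.InjOn.ncard_image, Set.ncard_coe_finset]
  intro i hi j hj
  simp only [Finset.coe_filter, Set.mem_ofPred_eq] at hi hj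
  exact h.kernelAt_inj hn hi.2 hj.2

/-- Marked positions belong to dominating vertices, and of two dominating vertices the later one is
adjacent to the earlier one. -/
theorem Prepared.card_le_cliqueNum (hL : T.IsArcList L)
    (h : Prepared n L.length (tailOf L) (headOf L) ord pos dom val) :
    ((Finset.range n).filter fun j => val j = 1).card ≤ T.toSimpleGraphInclusive.cliqueNum := by
  classical
  have hsub : ((Finset.range n).filter fun j => val j = 1) ⊆
      (Finset.univ.filter fun v : Fin n => dom v = 1).image fun v : Fin n => pos v := by
    intro j hj
    obtain ⟨hj, hd, -⟩ := (h.val_iff j).1 (Finset.mem_filter.1 hj).2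
    exact Finset.mem_image.2 ⟨(⟨ord j, h.ord_lt j hj⟩ : Fin n), by simpa using hd, h.pos_ord j hj⟩
  refine (Finset.card_le_card hsub).trans (Finset.card_image_le.trans ?_)
  have hclique : T.toSimpleGraphInclusive.IsClique
      ((Finset.univ.filter fun v : Fin n => dom v = 1 : Finset (Fin n)) : Set (Fin n)) := ?_
  · exact SimpleGraph.IsClique.card_le_cliqueNum (tc := hclique)
  intro u hu v hv hne
  simp only [Finset.coe_filter, Finset.mem_univ, true_and, Set.mem_ofPred_eq] at hu hv
  refine (SimpleGraph.fromRel_adj _ _ _).2 ⟨hne, ?_⟩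
  have hpne : pos u ≠ pos v := fun he => hne <| Fin.ext <| by
    rw [← h.ord_pos u u.2, he, h.ord_pos v v.2]
  rcases hpne.lt_or_gt with hlt | hlt
  · exact ((nbr_iff hL v u).1 ((h.adj_iff v v.2 u u.2 hlt).2 hv)).symm
  · exact (nbr_iff hL u v).1 ((h.adj_iff u u.2 v v.2 hlt).2 hu)

/-- No vertex is repeated: `ord` is injective on positions, and all listed vertices after `ord j`
have positions greater than `j`. -/
theorem Prepared.exists_list (hn : 0 < n)
    (h : Prepared n L.length (tailOf L) (headOf L) ord pos dom val) {j : ℕ} (hj : j < n) :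
    ∃ k : List (Fin n), k.map Fin.val = ord j :: laterIsolated n ord dom j ∧ k.Nodup ∧
      k.toFinset = kernelAt hn ord pos dom j := by
  have hmem : ∀ v < n, (v ∈ laterIsolated n ord dom j ↔ j < pos v ∧ dom v ≠ 1) := by
    intro v hv
    simp only [laterIsolated, List.mem_map, List.mem_filter, List.mem_range, decide_eq_true_eq]
    constructor
    · rintro ⟨i, ⟨h1, h2, h3⟩, rfl⟩
      rw [h.pos_ord i h1]
      exact ⟨h2, h3⟩
    · rintro ⟨h1, h2⟩
      exact ⟨pos v, ⟨h.pos_lt v hv, h1, by rwa [h.ord_pos v hv]⟩, h.ord_pos v hv⟩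
  have hlt : ∀ v ∈ ord j :: laterIsolated n ord dom j, v < n := by
    intro v hv
    rcases List.mem_cons.1 hv with rfl | hv
    · exact h.ord_lt j hj
    · simp only [laterIsolated, List.mem_map, List.mem_filter, List.mem_range] at hv
      obtain ⟨i, ⟨h1, -⟩, rfl⟩ := hv
      exact h.ord_lt i h1
  have hnodup : (ord j :: laterIsolated n ord dom j).Nodup := by
    refine List.nodup_cons.2 ⟨fun hm => ?_, ?_⟩
    · have := ((hmem _ (h.ord_lt j hj)).1 hm).1
      rw [h.pos_ord j hj] at this
      exact lt_irrefl _ this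
    · refine List.Nodup.map_on ?_ (List.nodup_range.filter _)
      intro a ha b hb hab
      have ha := List.mem_range.1 (List.mem_of_mem_filter ha)
      have hb := List.mem_range.1 (List.mem_of_mem_filter hb)
      rw [← h.pos_ord a ha, ← h.pos_ord b hb, hab]
  have hmap : ((ord j :: laterIsolated n ord dom j).pmap (fun v hv => (⟨v, hv⟩ : Fin n)) hlt).map
      Fin.val = ord j :: laterIsolated n ord dom j := by
    rw [List.map_pmap]
    simp
  refine ⟨_, hmap, List.Nodup.of_map Fin.val (by rw [hmap]; exact hnodup), ?_⟩
  ext v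
  rw [List.mem_toFinset, ← List.mem_map_of_injective Fin.val_injective, hmap, h.kernelAt_eq hn hj,
    Digraph.mem_candidate, List.mem_cons, hmem v v.2]
  simp only [h.pos_ord j hj, Fin.ext_iff, and_comm, ne_eq]

end

end RAM

/-! ### The two algorithms. -/

theorem mainTheorem6 :
    (∃ (P : RAM.Program) (C c : ℕ), ∀ (n : ℕ) (T : Digraph (Fin n)) (L : List (Fin n × Fin n)),
      T.IsLoopless → T.toSimpleGraphInclusive.IsThreshold → T.IsArcList L →
      ∃ k : List (Fin n),
        k.Nodup ∧
        ((∃ S, T.IsKernel S) → T.IsKernel k.toFinset) ∧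
        ((¬ ∃ S, T.IsKernel S) → k = []) ∧
        RAM.OutputsWithin ((T.size + 1) ^ c) P (RAM.input n L) (C * T.size)
          ({S : Finset (Fin n) | T.IsKernel S}.ncard :: k.map Fin.val)) ∧
    (∃ (P : RAM.Program) (C c : ℕ), ∀ (n : ℕ) (T : Digraph (Fin n)) (L : List (Fin n × Fin n)),
      T.IsLoopless → T.toSimpleGraphInclusive.IsThreshold → T.IsArcList L →
      ∃ K : List (List (Fin n)),
        (∀ k ∈ K, k.Nodup) ∧
        (K.map List.toFinset).Nodup ∧
        (∀ S : Finset (Fin n), S ∈ K.map List.toFinset ↔ T.IsKernel S) ∧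
        RAM.OutputsWithin ((T.size + 1) ^ c) P (RAM.input n L)
          (C * (T.toSimpleGraphInclusive.cliqueNum * n + T.size))
          (K.flatMap fun k => k.length :: k.map Fin.val)) := by
  have hpos : ∀ (n : ℕ) (T : Digraph (Fin n)), T.toSimpleGraphInclusive.IsThreshold → 0 < n :=
    fun n T hG => by
      obtain ⟨v, -⟩ := SimpleGraph.IsThresholdOn.nonempty hG
      exact v.pos
  -- Words must address the `n * n` matrix cells, so the exponent `c = 2` is used; `n > 0` makes the
  -- inequality strict.
  have hW : ∀ (n m : ℕ), 0 < n → n * n + n + m + 1 < (n + m + 1) ^ 2 := fun n m hn => by nlinarith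
  have hvar : ∀ (n : ℕ) (L : List (Fin n × Fin n)), ∀ x, 2 ≤ x → (RAM.input n L).var x = 0 :=
    fun n L x hx => by
      simp only [RAM.input]
      rw [if_neg (by omega), if_neg (by omega)]
  have harr : ∀ (n : ℕ) (L : List (Fin n × Fin n)), ∀ A, 2 ≤ A → ∀ i,
      (RAM.input n L).arr A i = 0 := fun n L A hA i => by
    simp only [RAM.input]
    rw [if_neg (by omega), if_neg (by omega)]
  -- The constant 100 absorbs the additive constants of the running times because `n ≥ 1`.
  refine ⟨⟨RAM.countKernels, 100, 2, fun n T L hT hG hL => ?_⟩,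
    ⟨RAM.enumKernels, 100, 2, fun n T L hT hG hL => ?_⟩⟩
  · have hn := hpos n T hG
    rw [hL.size_eq]
    obtain ⟨t, ht, s', he, ord, pos, dom, val, hP, h⟩ :=
      RAM.countKernels_run (RAM.arcData hT hL) (RAM.hasExtremal hT hG hL) (hW n L.length hn)
        (s := RAM.input n L) rfl rfl (hvar n L) (fun _ _ => rfl) (fun _ _ => rfl) (harr n L) rfl
    rw [hP.ncard_eq hT hL hn]
    have hiff := hP.isKernel_iff hT hL hn
    rcases h with ⟨h1, h2⟩ | ⟨j, hj, h2⟩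
    · have hno : ¬ ∃ S, T.IsKernel S := by
        rintro ⟨S, hS⟩
        obtain ⟨j, hj, -⟩ := (hiff S).1 hS
        have : j ∈ (Finset.range n).filter fun j => val j = 1 :=
          Finset.mem_filter.2 ⟨Finset.mem_range.2 (hP.val_lt hj), hj⟩
        rw [h1] at this
        exact absurd this (Finset.notMem_empty j)
      exact ⟨[], List.nodup_nil, fun h => absurd h hno, fun _ => rfl, t, by omega, s', he,
        by rw [h2, h1]; rfl⟩
    · obtain ⟨k, hk, hnodup, hfin⟩ := hP.exists_list hn (hP.val_lt hj)
      have hker : T.IsKernel k.toFinset := (hiff _).2 ⟨j, hj, hfin.symm⟩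
      exact ⟨k, hnodup, fun _ => hker, fun h => absurd ⟨_, hker⟩ h, t, by omega, s', he,
        by rw [h2, hk]⟩
  · have hn := hpos n T hG
    rw [hL.size_eq]
    obtain ⟨t, ht, s', he, ord, pos, dom, val, hP, h⟩ :=
      RAM.enumKernels_run (RAM.arcData hT hL) (RAM.hasExtremal hT hG hL) (hW n L.length hn)
        (s := RAM.input n L) rfl rfl (hvar n L) (fun _ _ => rfl) (fun _ _ => rfl) (harr n L) rfl
        (fun ord pos dom val hP => hP.card_le_cliqueNum hL)
    have hlist : ∀ j, ∃ k : List (Fin n), val j = 1 →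
        k.map Fin.val = ord j :: RAM.laterIsolated n ord dom j ∧ k.Nodup ∧
          k.toFinset = RAM.kernelAt hn ord pos dom j := fun j => by
      by_cases hj : val j = 1
      · obtain ⟨k, hk⟩ := hP.exists_list hn (hP.val_lt hj)
        exact ⟨k, fun _ => hk⟩
      · exact ⟨[], fun h => absurd h hj⟩
    choose k hk using hlist
    have hmem : ∀ j ∈ (List.range n).filter fun j => decide (val j = 1), val j = 1 :=
      fun j hj => by simpa using (List.mem_filter.1 hj).2
    refine ⟨((List.range n).filter fun j => decide (val j = 1)).map k, ?_, ?_, fun S => ?_, t, ?_,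
      s', he, ?_⟩
    · intro l hl
      obtain ⟨j, hj, rfl⟩ := List.mem_map.1 hl
      exact (hk j (hmem j hj)).2.1
    · rw [List.map_map]
      refine List.Nodup.map_on ?_ (List.nodup_range.filter _)
      intro i hi j hj hij
      refine hP.kernelAt_inj hn (hmem i hi) (hmem j hj) ?_
      rw [← (hk i (hmem i hi)).2.2, ← (hk j (hmem j hj)).2.2]
      exact hij
    · rw [hP.isKernel_iff hT hL hn, List.map_map, List.mem_map]
      constructor
      · rintro ⟨j, hj, rfl⟩
        exact ⟨j, hmem j hj, (hk j (hmem j hj)).2.2.symm⟩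
      · rintro ⟨j, hj, rfl⟩
        exact ⟨j, List.mem_filter.2 ⟨List.mem_range.2 (hP.val_lt hj), by simpa using hj⟩,
          (hk j hj).2.2⟩
    -- The part of the cost per kernel that does not depend on `n` is bounded by a multiple of `n`.
    · have : T.toSimpleGraphInclusive.cliqueNum * 1 ≤ T.toSimpleGraphInclusive.cliqueNum * n :=
        Nat.mul_le_mul_left _ hn
      nlinarith
    · rw [h, RAM.kernelLists, List.flatMap_map, List.flatMap_map]
      refine List.flatMap_congr fun j hj => ?_
      have := (hk j (hmem j hj)).1
      rw [this, ← List.length_map Fin.val, this]
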